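/- Let $(\overline M,\overline g)$ be a smooth $(n+2)$-dimensional Lorentzian manifold (signature $(-,+,\dots,+)$) with Levi-Civita connection $\overline\nabla$, and let $M$ be a connected lightlike hypersurface of $\overline M$, with induced degenerate metric $g$, whose radical distribution $\mathrm{Rad}\,TM=TM\cap TM^{\perp}$ is spanned by a globally defined nowhere vanishing smooth vector field $\xi$. Let $S(TM)$ be a screen distribution, i.e. a smooth rank-$n$ distribution with $TM=S(TM)\oplus \mathrm{Rad}\,TM$, let $P$ be the corresponding projection of $TM$ onto $S(TM)$, and let $N$ be the unique vector field of $T\overline M$ along $M$ with $\overline g(N,\xi)=1$, $\overline g(N,N)=0$ and $\overline g(N,W)=0$ for all $W\in S(TM)$. Put $\eta=\overline g(N,\cdot)$ on $TM$. Let $\nabla_XY=Q(\overline\nabla_XY)$ be the induced connection, $Q$ being the projection of $T\overline M|_M=TM\oplus\mathrm{span}\,N$ onto $TM$, and assume that $M$ is totally geodesic, i.e. $\overline\nabla_XY=\nabla_XY$ for all $X,Y\in\Gamma(TM)$. Let $C(X,PY)=\overline g\big((I-P)\nabla_XPY,N\big)$. Put $X^\flat=g(X,\cdot)+\eta(X)\eta$,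 and for $f\in C^\infty(M)$ let $\nabla^gf$ be the vector field determined by $(\nabla^gf)^\flat=df$. Let $S$ be an $\mathcal A^\nabla$-tensor on $(M,g,S(TM))$, i.e. a smooth field of endomorphisms of $TM$ with $PS=SP$, $g(SX,Y)=g(X,SY)$ for all $X,Y$, and $X^\flat\big(\nabla S(X,X)\big)=0$ for all $X\in\Gamma(TM)$, where $\nabla S(X,Y)=\nabla_X(SY)-S(\nabla_XY)$. Let $\lambda_0,\dots,\lambda_k\in C^\infty(M)$ be functions which at every point of $M$ are pairwise distinct and are exactly the eigenvalues of $S$ at that point, put $D_\alpha=\mathrm{Ker}(S-\lambda_\alpha I)$, and assume $D_0=\mathrm{Rad}\,TM$. Fix $i\in\{1,\dots,k\}$. Suppose that $\nabla^g\lambda_i$ is $D_0$-valued and that $C(X,X)=0$ for all $X\in\Gamma(D_i)$. Then the following assertions are equivalent on $M$: (a) $D_i$ is integrable (through every point of $M$ passes an integral manifold of $D_i$); (b) $\nabla S(X,Y)=0$ for all $X,Y\in\Gamma(D_i)$; (c) $D_i$ is autoparallel, i.e. $\nabla_XY\in\Gamma(D_i)$ for all $X,Y\in\Gamma(D_i)$.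 -/

import Mathlib

open Set Filter Topology Bundle
open scoped Manifold ContDiff

noncomputable section

namespace Lightlike

instance tangentFinite {m : ℕ} {N : Type*} [TopologicalSpace N]
    [ChartedSpace (EuclideanSpace ℝ (Fin m)) N] (x : N) :
    FiniteDimensional ℝ (TangentSpace (𝓡 m) x) :=
  inferInstanceAs (FiniteDimensional ℝ (EuclideanSpace ℝ (Fin m)))

lemma finrank_tangent {m : ℕ} {N : Type*} [TopologicalSpace N]
    [ChartedSpace (EuclideanSpace ℝ (Fin m)) N] (x : N) :
    Module.finrank ℝ (TangentSpace (𝓡 m) x) = m :=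
  (finrank_euclideanSpace_fin : Module.finrank ℝ (EuclideanSpace ℝ (Fin m)) = m)

/-! ### Vector fields and distributions -/

/-- Vector fields on `N`, without any regularity. -/
abbrev VField (m : ℕ) (N : Type*) [TopologicalSpace N]
    [ChartedSpace (EuclideanSpace ℝ (Fin m)) N] :=
  ∀ x : N, TangentSpace (𝓡 m) x

/-- Fields of subspaces of the tangent spaces of `N`, without any regularity. -/
abbrev Distrib (m : ℕ) (N : Type*) [TopologicalSpace N]
    [ChartedSpace (EuclideanSpace ℝ (Fin m)) N] :=
  ∀ x : N, Submodule ℝ (TangentSpace (𝓡 m) x)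

section Distributions

variable {m : ℕ} {N : Type*} [TopologicalSpace N]
  [ChartedSpace (EuclideanSpace ℝ (Fin m)) N] [IsManifold (𝓡 m) ∞ N]

/-- Smoothness of a vector field on a set. -/
def SmoothFieldOn (X : VField m N) (U : Set N) : Prop :=
  ContMDiffOn (𝓡 m) ((𝓡 m).prod 𝓘(ℝ, EuclideanSpace ℝ (Fin m))) ∞
    (fun x ↦ TotalSpace.mk' (EuclideanSpace ℝ (Fin m)) x (X x)) U

/-- `Γ(TN)`: the globally defined smooth vector fields. -/
def SmoothField (X : VField m N) : Prop :=
  ContMDiff (𝓡 m) ((𝓡 m).prod 𝓘(ℝ, EuclideanSpace ℝ (Fin m))) ∞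
    (fun x ↦ TotalSpace.mk' (EuclideanSpace ℝ (Fin m)) x (X x))

/-- Smoothness of a field of endomorphisms of the tangent spaces, i.e. of a `(1,1)`-tensor. -/
def SmoothEnd (S : ∀ x : N, TangentSpace (𝓡 m) x →L[ℝ] TangentSpace (𝓡 m) x) : Prop :=
  ContMDiff (𝓡 m)
    ((𝓡 m).prod 𝓘(ℝ, EuclideanSpace ℝ (Fin m) →L[ℝ] EuclideanSpace ℝ (Fin m))) ∞
    (fun x ↦ TotalSpace.mk' (EuclideanSpace ℝ (Fin m) →L[ℝ] EuclideanSpace ℝ (Fin m))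
      (E := fun x : N ↦ TangentSpace (𝓡 m) x →L[ℝ] TangentSpace (𝓡 m) x) x (S x))

/-- `X ∈ Γ(D)`: `X` is a smooth vector field with values in `D`. -/
def IsSection (D : Distrib m N) (X : VField m N) : Prop :=
  SmoothField X ∧ ∀ x, X x ∈ D x

/-- `D` is a smooth distribution of rank `r`: around each point it has a smooth frame. -/
def IsSmoothDistrib (r : ℕ) (D : Distrib m N) : Prop :=
  ∀ x : N, ∃ U ∈ 𝓝 x, ∃ F : Fin r → VField m N,
    (∀ j, SmoothFieldOn (F j) U) ∧
    ∀ y ∈ U, LinearIndependent ℝ (fun j ↦ F j y) ∧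
      Submodule.span ℝ (range fun j ↦ F j y) = D y

/-- `D` is integrable: through each point passes an integral manifold of `D`, given by a smooth
immersive local parametrization `φ` around that point; its tangent spaces are the subspaces
of `D`. -/
def IsIntegrable (D : Distrib m N) : Prop :=
  ∀ x : N, ∃ (r : ℕ) (U : Set (EuclideanSpace ℝ (Fin r))) (φ : EuclideanSpace ℝ (Fin r) → N),
    IsOpen U ∧ (0 : EuclideanSpace ℝ (Fin r)) ∈ U ∧ φ 0 = x ∧
    ContMDiffOn (𝓡 r) (𝓡 m) ∞ φ U ∧
    ∀ u ∈ U, Function.Injective (mfderiv (𝓡 r) (𝓡 m) φ u) ∧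
      LinearMap.range (mfderiv (𝓡 r) (𝓡 m) φ u).toLinearMap = D (φ u)

end Distributions

/-! ### Lorentzian metrics and the Levi-Civita connection -/

/-- A smooth metric of Lorentzian signature `(-, +, …, +)` on a manifold of dimension `m`. -/
structure LorentzMetric (m : ℕ) (N : Type*) [TopologicalSpace N]
    [ChartedSpace (EuclideanSpace ℝ (Fin m)) N] [IsManifold (𝓡 m) ∞ N] where
  inner (x : N) : TangentSpace (𝓡 m) x →L[ℝ] TangentSpace (𝓡 m) x →L[ℝ] ℝ
  symm (x : N) (v w : TangentSpace (𝓡 m) x) : inner x v w = inner x w v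
  /-- there is a timelike vector, and the metric is positive definite on its orthogonal -/
  lorentz (x : N) : ∃ v : TangentSpace (𝓡 m) x, inner x v v < 0 ∧
    ∀ w, inner x v w = 0 → w ≠ 0 → 0 < inner x w w
  contMDiff : ContMDiff (𝓡 m)
    ((𝓡 m).prod 𝓘(ℝ, EuclideanSpace ℝ (Fin m) →L[ℝ] EuclideanSpace ℝ (Fin m) →L[ℝ] ℝ)) ∞
    (fun x ↦ TotalSpace.mk' (EuclideanSpace ℝ (Fin m) →L[ℝ] EuclideanSpace ℝ (Fin m) →L[ℝ] ℝ)
      (E := fun x : N ↦ TangentSpace (𝓡 m) x →L[ℝ] TangentSpace (𝓡 m) x →L[ℝ] ℝ) x (inner x))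

namespace LorentzMetric

variable {m : ℕ} {N : Type*} [TopologicalSpace N]
  [ChartedSpace (EuclideanSpace ℝ (Fin m)) N] [IsManifold (𝓡 m) ∞ N]
  (G : LorentzMetric m N)

/-- The metric at `x` as a bilinear form. -/
def form (x : N) : LinearMap.BilinForm ℝ (TangentSpace (𝓡 m) x) :=
  LinearMap.mk₂ ℝ (fun v w ↦ G.inner x v w) (by simp) (by simp) (by simp) (by simp)

lemma form_apply (x : N) (v w : TangentSpace (𝓡 m) x) : G.form x v w = G.inner x v w := rfl

lemma nondegenerate (x : N) : (G.form x).Nondegenerate := by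
  have key : ∀ y : TangentSpace (𝓡 m) x, (∀ z, G.inner x y z = 0) → y = 0 := by
    intro y hy
    obtain ⟨v, -, hv⟩ := G.lorentz x
    by_contra hne
    have h1 := hv y (by rw [G.symm]; exact hy v) hne
    rw [hy y] at h1
    exact lt_irrefl _ h1
  refine ⟨fun y hy ↦ key y hy, fun y hy ↦ key y fun z ↦ ?_⟩
  rw [G.symm]; exact hy z

/-- The metric read in the chart around `c`: at `x` in the range of that chart, the pullback of
the metric by the inverse of the chart. -/
def inChart (c : N) (x : EuclideanSpace ℝ (Fin m)) :
    EuclideanSpace ℝ (Fin m) →L[ℝ] EuclideanSpace ℝ (Fin m) →L[ℝ] ℝ :=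
  let A : EuclideanSpace ℝ (Fin m) →L[ℝ] EuclideanSpace ℝ (Fin m) :=
    mfderiv 𝓘(ℝ, EuclideanSpace ℝ (Fin m)) (𝓡 m) (extChartAt (𝓡 m) c).symm x
  let B : EuclideanSpace ℝ (Fin m) →L[ℝ] EuclideanSpace ℝ (Fin m) →L[ℝ] ℝ :=
    G.inner ((extChartAt (𝓡 m) c).symm x)
  B.bilinearComp A A

/-- The Christoffel symbols of the first kind in the chart around `c`, as the trilinear form
`Γ(u, w, z) = (∂_u g(w, z) + ∂_w g(u, z) - ∂_z g(u, w)) / 2`. -/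
def christoffel (c : N) (x u w : EuclideanSpace ℝ (Fin m)) : EuclideanSpace ℝ (Fin m) →L[ℝ] ℝ :=
  (2⁻¹ : ℝ) • (fderiv ℝ (G.inChart c) x u w + fderiv ℝ (G.inChart c) x w u
    - ((fderiv ℝ (G.inChart c) x).flip u).flip w)

/-- `∇̄_v V` for the Levi-Civita connection `∇̄` of `G`, a vector field `V` along a map
`f : M → N` and a tangent vector `v` of `M` at `p`. In the chart `χ` of `N` around `f p`, with
`V` read there as the map `V̂ = dχ(V)`, this is the vector `dV̂(v) + Γ(dχ(df v), V̂(p))`. -/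
def covAlong {k : ℕ} {M : Type*} [TopologicalSpace M]
    [ChartedSpace (EuclideanSpace ℝ (Fin k)) M] (f : M → N)
    (V : ∀ q : M, TangentSpace (𝓡 m) (f q)) (p : M) (v : TangentSpace (𝓡 k) p) :
    TangentSpace (𝓡 m) (f p) :=
  let χ : N → EuclideanSpace ℝ (Fin m) := extChartAt (𝓡 m) (f p)
  let dχ : ∀ y : N, TangentSpace (𝓡 m) y →L[ℝ] EuclideanSpace ℝ (Fin m) :=
    fun y ↦ mfderiv (𝓡 m) 𝓘(ℝ, EuclideanSpace ℝ (Fin m)) χ y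
  let Vhat : M → EuclideanSpace ℝ (Fin m) := fun q ↦ dχ (f q) (V q)
  (dχ (f p)).inverse (mfderiv (𝓡 k) 𝓘(ℝ, EuclideanSpace ℝ (Fin m)) Vhat p v) +
    ((G.form (f p)).toDual (G.nondegenerate (f p))).symm
      (((G.christoffel (f p) (χ (f p)) (dχ (f p) (mfderiv (𝓡 k) (𝓡 m) f p v)) (Vhat p)).comp
        (dχ (f p))).toLinearMap)

end LorentzMetric

/-! ### Lightlike hypersurfaces -/

section Lightlike

variable {n : ℕ} {Mbar : Type*} [TopologicalSpace Mbar]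
  [ChartedSpace (EuclideanSpace ℝ (Fin (n + 2))) Mbar] [IsManifold (𝓡 (n + 2)) ∞ Mbar]

/-- A lightlike (immersed) hypersurface `M` of the Lorentzian manifold `(Mbar, G)`, together with
a global nowhere vanishing smooth section `ξ` of `TM ∩ TM^⊥`. -/
structure Hypersurface (G : LorentzMetric (n + 2) Mbar) (M : Type*) [TopologicalSpace M]
    [ChartedSpace (EuclideanSpace ℝ (Fin (n + 1))) M] [IsManifold (𝓡 (n + 1)) ∞ M] where
  toFun : M → Mbar
  smooth : ContMDiff (𝓡 (n + 1)) (𝓡 (n + 2)) ∞ toFun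
  immersion : ∀ p, Function.Injective (mfderiv (𝓡 (n + 1)) (𝓡 (n + 2)) toFun p)
  ξ : VField (n + 1) M
  ξ_smooth : SmoothField ξ
  ξ_ne_zero : ∀ p, ξ p ≠ 0
  ξ_radical : ∀ p (w : TangentSpace (𝓡 (n + 1)) p),
    G.inner (toFun p) (mfderiv (𝓡 (n + 1)) (𝓡 (n + 2)) toFun p (ξ p))
      (mfderiv (𝓡 (n + 1)) (𝓡 (n + 2)) toFun p w) = 0

namespace Hypersurface

variable {G : LorentzMetric (n + 2) Mbar} {M : Type*} [TopologicalSpace M]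
    [ChartedSpace (EuclideanSpace ℝ (Fin (n + 1))) M] [IsManifold (𝓡 (n + 1)) ∞ M]
    (H : Hypersurface G M)

/-- The inclusion `T_pM → T_pMbar`. -/
def d (p : M) : TangentSpace (𝓡 (n + 1)) p →L[ℝ] TangentSpace (𝓡 (n + 2)) (H.toFun p) :=
  mfderiv (𝓡 (n + 1)) (𝓡 (n + 2)) H.toFun p

/-- The induced degenerate metric `g` of `M`. -/
def g (p : M) (v w : TangentSpace (𝓡 (n + 1)) p) : ℝ :=
  G.inner (H.toFun p) (H.d p v) (H.d p w)

/-- The radical distribution `Rad TM = TM ∩ TM^⊥`. -/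
def rad : Distrib (n + 1) M := fun p ↦
  { carrier := {v | ∀ w, H.g p v w = 0}
    add_mem' := fun ha hb w ↦ by simp only [g, map_add, add_apply] at *; rw [ha w, hb w, add_zero]
    zero_mem' := fun w ↦ by simp [g]
    smul_mem' := fun c x hx w ↦ by
      simp only [g, map_smul, smul_apply, smul_eq_mul] at *; rw [hx w, mul_zero] }

lemma d_injective (p : M) : Function.Injective (H.d p) := H.immersion p

lemma g_symm (p : M) (v w : TangentSpace (𝓡 (n + 1)) p) : H.g p v w = H.g p w v := G.symm _ _ _

lemma ξ_mem_rad (p : M) : H.ξ p ∈ H.rad p := H.ξ_radical p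

lemma g_nonneg_aux (p : M) (v : TangentSpace (𝓡 (n + 1)) p) :
    0 ≤ H.g p v v ∧ (H.g p v v = 0 → ∃ c : ℝ, v = c • H.ξ p) := by
  obtain ⟨t, -, ht⟩ := G.lorentz (H.toFun p)
  have hξ : H.d p (H.ξ p) ≠ 0 := fun h ↦
    H.ξ_ne_zero p (H.d_injective p (by rw [h, map_zero]))
  have ha : G.inner (H.toFun p) t (H.d p (H.ξ p)) ≠ 0 := fun h ↦ by
    have h1 := ht _ h hξ
    have h2 : G.inner (H.toFun p) (H.d p (H.ξ p)) (H.d p (H.ξ p)) = 0 := H.ξ_radical p _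
    exact h1.ne' h2
  set c : ℝ := G.inner (H.toFun p) t (H.d p v) / G.inner (H.toFun p) t (H.d p (H.ξ p)) with hc
  have horth : G.inner (H.toFun p) t (H.d p (v - c • H.ξ p)) = 0 := by
    simp only [map_sub, map_smul, smul_eq_mul]
    rw [hc, div_mul_cancel₀ _ ha, sub_self]
  have hr : ∀ w, G.inner (H.toFun p) (H.d p (H.ξ p)) (H.d p w) = 0 := H.ξ_radical p
  have hval : G.inner (H.toFun p) (H.d p (v - c • H.ξ p)) (H.d p (v - c • H.ξ p)) =
      H.g p v v := by
    simp only [g, map_sub, map_smul, sub_apply, smul_apply, smul_eq_mul, hr,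
      G.symm _ (H.d p v) (H.d p (H.ξ p))]
    ring
  by_cases h0 : H.d p (v - c • H.ξ p) = 0
  · refine ⟨by rw [← hval, h0]; simp, fun _ ↦ ⟨c, ?_⟩⟩
    exact sub_eq_zero.mp (H.d_injective p (by rw [h0, map_zero]))
  · have := ht _ horth h0
    rw [hval] at this
    exact ⟨this.le, fun h ↦ absurd h this.ne'⟩

/-- A screen distribution `S(TM)` of `M`: a smooth distribution of rank `n` complementary to
`Rad TM`. -/
structure Screen where
  dist : Distrib (n + 1) M
  smooth : IsSmoothDistrib n dist
  isCompl : ∀ p, IsCompl (dist p) (H.rad p)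

namespace Screen

variable {H} (Sc : H.Screen)

/-- The projection `P` of `TM` on `S(TM)` along `Rad TM`. -/
def P (p : M) : TangentSpace (𝓡 (n + 1)) p →ₗ[ℝ] TangentSpace (𝓡 (n + 1)) p :=
  (Sc.dist p).projection (H.rad p) (Sc.isCompl p)

theorem exists_transversal (p : M) : ∃ N : TangentSpace (𝓡 (n + 2)) (H.toFun p),
    G.inner (H.toFun p) N (H.d p (H.ξ p)) = 1 ∧ G.inner (H.toFun p) N N = 0 ∧
    ∀ w ∈ Sc.dist p, G.inner (H.toFun p) N (H.d p w) = 0 := by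
  have hnot : H.d p (H.ξ p) ∉ (Sc.dist p).map (H.d p).toLinearMap := by
    rintro ⟨w, hw, hwe⟩
    have : w = H.ξ p := H.d_injective p hwe
    subst this
    exact H.ξ_ne_zero p
      ((Submodule.disjoint_def.mp (Sc.isCompl p).disjoint) _ hw (H.ξ_mem_rad p))
  obtain ⟨L, hL, hL0⟩ := Submodule.exists_le_ker_of_notMem hnot
  obtain ⟨u, hu⟩ : ∃ u : TangentSpace (𝓡 (n + 2)) (H.toFun p),
      ∀ z, G.inner (H.toFun p) u z = (L (H.d p (H.ξ p)))⁻¹ * L z := by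
    refine ⟨((G.form _).toDual (G.nondegenerate _)).symm ((L (H.d p (H.ξ p)))⁻¹ • L), fun z ↦ ?_⟩
    have := LinearMap.BilinForm.apply_toDual_symm_apply (B := G.form (H.toFun p))
      (hB := G.nondegenerate _) ((L (H.d p (H.ξ p)))⁻¹ • L) z
    rw [LorentzMetric.form_apply] at this
    rw [this]
    rfl
  have h1 : G.inner (H.toFun p) u (H.d p (H.ξ p)) = 1 := by rw [hu]; exact inv_mul_cancel₀ hL
  have hr : ∀ w, G.inner (H.toFun p) (H.d p (H.ξ p)) (H.d p w) = 0 := H.ξ_radical p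
  refine ⟨u - (2⁻¹ * G.inner (H.toFun p) u u) • H.d p (H.ξ p), ?_, ?_, fun w hw ↦ ?_⟩
  · simp only [map_sub, map_smul, sub_apply, smul_apply, smul_eq_mul, hr, h1]; ring
  · simp only [map_sub, map_smul, sub_apply, smul_apply, smul_eq_mul, hr, h1,
      G.symm _ (H.d p (H.ξ p)) u]
    ring
  · have : L (H.d p w) = 0 := hL0 ⟨w, hw, rfl⟩
    simp only [map_sub, map_smul, sub_apply, smul_apply, smul_eq_mul, hr, hu, this]; ring

/-- The null transversal `N` of the normalizing pair `{ξ, N}`: it is characterized by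
`⟨N, ξ⟩ = 1`, `⟨N, N⟩ = 0` and `⟨N, W⟩ = 0` for `W` in `S(TM)`. -/
def N (p : M) : TangentSpace (𝓡 (n + 2)) (H.toFun p) := (Sc.exists_transversal p).choose

lemma N_ξ (p : M) : G.inner (H.toFun p) (Sc.N p) (H.d p (H.ξ p)) = 1 :=
  (Sc.exists_transversal p).choose_spec.1

/-- The one-form `η = ⟨N, ·⟩` on `M`. -/
def η (p : M) : TangentSpace (𝓡 (n + 1)) p →ₗ[ℝ] ℝ :=
  (G.form (H.toFun p) (Sc.N p)).comp (H.d p).toLinearMap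

lemma isCompl_transversal (p : M) :
    IsCompl (LinearMap.range (H.d p).toLinearMap) (Submodule.span ℝ {Sc.N p}) := by
  have hN : Sc.N p ≠ 0 := fun h ↦ by have := Sc.N_ξ p; rw [h] at this; simp at this
  have hdis : Disjoint (LinearMap.range (H.d p).toLinearMap) (Submodule.span ℝ {Sc.N p}) := by
    rw [Submodule.disjoint_def]
    rintro x ⟨v, rfl⟩ hx
    obtain ⟨c, hc⟩ := Submodule.mem_span_singleton.mp hx
    have h0 : G.inner (H.toFun p) (H.d p v) (H.d p (H.ξ p)) = 0 := by
      rw [G.symm]; exact H.ξ_radical p v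
    change _ = H.d p v at hc
    rw [← hc] at h0
    simp only [map_smul, smul_apply, Sc.N_ξ, smul_eq_mul, mul_one] at h0
    change H.d p v = 0
    rw [← hc, h0, zero_smul]
  refine ⟨hdis, codisjoint_iff.mpr (Submodule.eq_top_of_disjoint _ _ ?_ hdis)⟩
  rw [finrank_span_singleton hN, LinearMap.finrank_range_of_inj (H.d_injective p),
    finrank_tangent, finrank_tangent]

/-- The projection `Q` of `TMbar` on `TM` along the transversal bundle `tr(TM) = span N`. -/
def Q (p : M) : TangentSpace (𝓡 (n + 2)) (H.toFun p) →ₗ[ℝ] TangentSpace (𝓡 (n + 1)) p :=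
  LinearMap.linearProjOfIsCompl (Submodule.span ℝ {Sc.N p}) (H.d p).toLinearMap
    (H.d_injective p) (Sc.isCompl_transversal p)

/-- The induced connection `∇_X Y = Q(∇̄_X Y)`. -/
def nabla (X Y : VField (n + 1) M) : VField (n + 1) M := fun p ↦
  Sc.Q p (G.covAlong H.toFun (fun q ↦ H.d q (Y q)) p (X p))

/-- The second fundamental form `h(X, Y) = ∇̄_X Y - ∇_X Y`. -/
def h (X Y : VField (n + 1) M) (p : M) : TangentSpace (𝓡 (n + 2)) (H.toFun p) :=
  G.covAlong H.toFun (fun q ↦ H.d q (Y q)) p (X p) - H.d p (Sc.nabla X Y p)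

/-- `M` is totally geodesic: its second fundamental form vanishes. -/
def IsTotallyGeodesic : Prop :=
  ∀ X Y : VField (n + 1) M, SmoothField X → SmoothField Y → ∀ p, Sc.h X Y p = 0

/-- The second fundamental form of the screen, `h*(X, PY) = ∇_X PY - P(∇_X PY)`. -/
def hstar (X Y : VField (n + 1) M) : VField (n + 1) M := fun p ↦
  Sc.nabla X (fun q ↦ Sc.P q (Y q)) p - Sc.P p (Sc.nabla X (fun q ↦ Sc.P q (Y q)) p)

/-- The local second fundamental form of the screen, `C(X, PY) = ⟨h*(X, PY), N⟩`. -/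
def C (X Y : VField (n + 1) M) (p : M) : ℝ :=
  G.inner (H.toFun p) (H.d p (Sc.hstar X Y p)) (Sc.N p)

/-- The map `X ↦ X^♭ = g(X, ·) + η(X) η`. -/
def flat (p : M) : TangentSpace (𝓡 (n + 1)) p →ₗ[ℝ]
    Module.Dual ℝ (TangentSpace (𝓡 (n + 1)) p) :=
  (G.form (H.toFun p)).compl₁₂ (H.d p).toLinearMap (H.d p).toLinearMap +
    (Sc.η p).smulRight (Sc.η p)

lemma flat_apply (p : M) (v w : TangentSpace (𝓡 (n + 1)) p) :
    Sc.flat p v w = H.g p v w + Sc.η p v * Sc.η p w := rfl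

lemma flat_injective (p : M) : Function.Injective (Sc.flat p) := by
  rw [← LinearMap.ker_eq_bot, LinearMap.ker_eq_bot']
  intro v hv
  have h0 : H.g p v v + Sc.η p v * Sc.η p v = 0 := by rw [← flat_apply, hv]; rfl
  obtain ⟨h1, h2⟩ := H.g_nonneg_aux p v
  have h3 := mul_self_nonneg (Sc.η p v)
  obtain ⟨c, rfl⟩ := h2 (by linarith)
  have h4 : Sc.η p (c • H.ξ p) = 0 := mul_self_eq_zero.mp (by linarith)
  have h5 : Sc.η p (H.ξ p) = 1 := Sc.N_ξ p
  rw [map_smul, h5, smul_eq_mul, mul_one] at h4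
  rw [h4, zero_smul]

/-- The isomorphism `♭ : TM → T*M`; its inverse is `♯`. -/
def flatEquiv (p : M) : TangentSpace (𝓡 (n + 1)) p ≃ₗ[ℝ]
    Module.Dual ℝ (TangentSpace (𝓡 (n + 1)) p) :=
  LinearEquiv.ofInjectiveOfFinrankEq (Sc.flat p) (Sc.flat_injective p)
    Subspace.dual_finrank_eq.symm

/-- The gradient `∇^g f`, defined by `g̃(∇^g f, ·) = df` where `g̃(X, Y) = X^♭(Y)`. -/
def grad (f : M → ℝ) : VField (n + 1) M := fun p ↦
  (Sc.flatEquiv p).symm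
    (mfderiv (𝓡 (n + 1)) 𝓘(ℝ, ℝ) f p : TangentSpace (𝓡 (n + 1)) p →L[ℝ] ℝ).toLinearMap

/-- `∇S(X, Y) = ∇_X(SY) - S(∇_X Y)`. -/
def covEnd (S : ∀ p : M, TangentSpace (𝓡 (n + 1)) p →L[ℝ] TangentSpace (𝓡 (n + 1)) p)
    (X Y : VField (n + 1) M) : VField (n + 1) M := fun p ↦
  Sc.nabla X (fun q ↦ S q (Y q)) p - S p (Sc.nabla X Y p)

/-- `S` is an `A^∇`-tensor on `(M, g, S(TM))`. -/
structure IsATensor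
    (S : ∀ p : M, TangentSpace (𝓡 (n + 1)) p →L[ℝ] TangentSpace (𝓡 (n + 1)) p) : Prop where
  smooth : SmoothEnd S
  screen_preserving : ∀ p v, Sc.P p (S p v) = S p (Sc.P p v)
  symmetric : ∀ p v w, H.g p (S p v) w = H.g p v (S p w)
  killing : ∀ X : VField (n + 1) M, SmoothField X →
    ∀ p, Sc.flat p (X p) (Sc.covEnd S X X p) = 0

/-- `D` is autoparallel: `∇_X Y` takes its values in `D` for all `X, Y ∈ Γ(D)`. -/
def IsAutoparallel (D : Distrib (n + 1) M) : Prop :=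
  ∀ X Y : VField (n + 1) M, IsSection D X → IsSection D Y → ∀ p, Sc.nabla X Y p ∈ D p

end Screen

end Hypersurface

/-- The eigendistribution `Ker(S - lam I)` of a field of endomorphisms for the function `lam`. -/
def eigenDistrib {m : ℕ} {M : Type*} [TopologicalSpace M]
    [ChartedSpace (EuclideanSpace ℝ (Fin m)) M]
    (S : ∀ p : M, TangentSpace (𝓡 m) p →L[ℝ] TangentSpace (𝓡 m) p) (lam : M → ℝ) :
    Distrib m M :=
  fun p ↦ Module.End.eigenspace (S p).toLinearMap (lam p)

/-- `lam₀, …, lam_k ∈ C^∞(M)` are the eigenfunctions of `S`: at each point they are distinct and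
they are all the eigenvalues of `S` there. In particular the number of distinct eigenvalues of `S`
is constant on `M`. -/
structure IsEigenfunctions {m k : ℕ} {M : Type*} [TopologicalSpace M]
    [ChartedSpace (EuclideanSpace ℝ (Fin m)) M]
    (S : ∀ p : M, TangentSpace (𝓡 m) p →L[ℝ] TangentSpace (𝓡 m) p)
    (lam : Fin (k + 1) → M → ℝ) : Prop where
  smooth : ∀ a, ContMDiff (𝓡 m) 𝓘(ℝ, ℝ) ∞ (lam a)
  distinct : ∀ p, Function.Injective fun a ↦ lam a p
  spectrum : ∀ p μ, Module.End.HasEigenvalue (S p).toLinearMap μ ↔ ∃ a, lam a p = μ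

end Lightlike

end Lightlike

end

open Lightlike

set_option linter.unusedSectionVars false

noncomputable section

/-! ### Total differential equations `Dφ = A ∘ φ` -/

section

open Metric NNReal

/-! For X, Y ∈ Γ(D_i) the Leibniz rule gives ∇S(X, Y) = X(λ_i) Y + (λ_i - S)∇_X Y. As i ≠ 0, η
vanishes on D_i, and a gradient with values in D_0 = Rad TM pairs to zero under ♭ with every vector
killed by η. Hence X(λ_i) = 0, and ∇S(X, Y) = 0 exactly when ∇_X Y ∈ D_i: this is (b) ⇔ (c), see
`covEnd_eq_zero_iff`. Since ∇ is torsion free, (c) makes D_i involutive, and Frobenius' theorem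
gives (a).

The substance is (a) ⇒ (b), in `covEnd_eq_zero_of_isIntegrable`. Involutivity makes E = ∇S(X, Y)
symmetric in X and Y. Polarizing C(X, X) = 0 and using η([X, Y]) = 0 gives η(∇_X Y) = 0, hence η(E)
= 0. Apply the polarized Killing condition to X, Y and a field Z equal to E at the given point. The
endomorphism ∇_X S is g-symmetric because the induced connection of a totally geodesic M is metric,
and the terms that differentiate along Z vanish. What remains is 4 g(E, E) = 0. Since g is positive
semidefinite with null vectors spanned by ξ, and η(E) = 0, it follows that E = 0.

Frobenius' theorem is needed in both directions, and it is phrased with the spectral projector of S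
onto D_i. The form X^♭(Y) is positive definite and S is self-adjoint for it, so S is diagonalizable
and the Lagrange product of the (S - λ_j) / (λ_i - λ_j), j ≠ i, is a smooth projector field. For a
projector field E with range D, involutivity of D means that DE(a)b is symmetric in a, b ∈ D
(`chartBracket_sub_chartProj`). A frame of D normalized over a fixed subspace turns this into the
solvability condition of `Dφ = A ∘ φ`, which is solved along rays from the origin
(`norm_ray_sub_le`). -/

lemma exists_mem_closedBall_hasDerivWithinAt {E : Type*} [NormedAddCommGroup E] [NormedSpace ℝ E]
    [CompleteSpace E] {f : ℝ → E → E} {tmin tmax : ℝ} {t₀ : Icc tmin tmax} {x₀ x : E}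
    {a r L K : ℝ≥0} (hf : IsPicardLindelof f t₀ x₀ a r L K) (hx : x ∈ closedBall x₀ r) :
    ∃ α : ℝ → E, α t₀ = x ∧ (∀ t, α t ∈ closedBall x₀ a) ∧
      ∀ t ∈ Icc tmin tmax, HasDerivWithinAt α (f t (α t)) (Icc tmin tmax) t := by
  -- The solution is the fixed point of the Picard map. Its extension `compProj`, constant on either
  -- side of the interval, stays in the ball for every real time.
  obtain ⟨α, hα⟩ := ODE.FunSpace.exists_isFixedPt_next hf hx
  refine ⟨α.compProj, by rw [ODE.FunSpace.compProj_val, ← hα, ODE.FunSpace.next_apply₀],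
    fun t ↦ α.compProj_mem_closedBall hf.mul_max_le, fun t ht ↦ ?_⟩
  apply ODE.hasDerivWithinAt_picard_Icc t₀.2 hf.continuousOn_uncurry
    α.continuous_compProj.continuousOn (fun _ ht' ↦ α.compProj_mem_closedBall hf.mul_max_le)
    x ht |>.congr_of_mem _ ht
  intro t' ht'
  nth_rw 1 [← hα]
  rw [ODE.FunSpace.compProj_of_mem ht', ODE.FunSpace.next_apply]

/-- Grönwall on `[0, 1]` for a function vanishing at `0`. -/
lemma norm_le_mul_exp_of_deriv_le {E : Type*} [NormedAddCommGroup E] [NormedSpace ℝ E]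
    {f f' : ℝ → E} {K ε : ℝ} (hK : 1 ≤ K) (hε : 0 ≤ ε)
    (hf : ∀ t ∈ Icc (0 : ℝ) 1, HasDerivWithinAt f (f' t) (Icc 0 1) t) (h0 : f 0 = 0)
    (hb : ∀ t ∈ Icc (0 : ℝ) 1, ‖f' t‖ ≤ K * ‖f t‖ + ε) {t : ℝ} (ht : t ∈ Icc (0 : ℝ) 1) :
    ‖f t‖ ≤ ε * Real.exp K := by
  have h := norm_le_gronwallBound_of_norm_deriv_right_le (f := f) (f' := f') (δ := 0) (K := K)
    (ε := ε) (a := 0) (b := 1) (fun s hs ↦ (hf s hs).continuousWithinAt)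
    (fun s hs ↦ (hf s ⟨hs.1, hs.2.le⟩).mono_of_mem_nhdsWithin
      (mem_of_superset (Ico_mem_nhdsGE hs.2) fun y hy ↦ ⟨hs.1.trans hy.1, hy.2.le⟩))
    (by simp [h0]) (fun s hs ↦ hb s ⟨hs.1, hs.2.le⟩) t ht
  refine h.trans ?_
  -- The bound is now `ε / K * (exp (K * (t - 0)) - 1)`, and `K ≥ 1` absorbs the denominator.
  rw [gronwallBound_of_K_ne_0 (by positivity)]
  have h1 : Real.exp (K * (t - 0)) ≤ Real.exp K := Real.exp_le_exp.mpr (by nlinarith [ht.1, ht.2])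
  have h2 : ε / K ≤ ε := div_le_self hε hK
  have h3 : 1 ≤ Real.exp (K * (t - 0)) := Real.one_le_exp (by nlinarith [ht.1])
  have h4 : 0 ≤ ε / K := by positivity
  nlinarith [Real.exp_pos K]

section Rays

variable {E F : Type*} [NormedAddCommGroup E] [NormedSpace ℝ E]
  [NormedAddCommGroup F] [NormedSpace ℝ F]

/-- On a convex set where `DA` is `K`-Lipschitz, the first order Taylor remainder of `A` is
quadratic. -/
lemma norm_taylor_le {W : Type*} [NormedAddCommGroup W] [NormedSpace ℝ W] {A : E → W}
    {A' : E → E →L[ℝ] W} {s : Set E} (hs : Convex ℝ s) {K : ℝ} (hK : 0 ≤ K)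
    (hA : ∀ y ∈ s, HasFDerivAt A (A' y) y)
    (hl : ∀ y ∈ s, ∀ z ∈ s, ‖A' y - A' z‖ ≤ K * ‖y - z‖) {x y : E} (hx : x ∈ s) (hy : y ∈ s) :
    ‖A y - A x - A' x (y - x)‖ ≤ K * ‖y - x‖ ^ 2 := by
  have hsub : segment ℝ x y ⊆ s := hs.segment_subset hx hy
  have := (convex_segment x y).norm_image_sub_le_of_norm_hasFDerivWithin_le' (f := A) (f' := A')
    (φ := A' x) (C := K * ‖y - x‖) (fun z hz ↦ (hA z (hsub hz)).hasFDerivWithinAt)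
    (fun z hz ↦ (hl z (hsub hz) x hx).trans ?_) (left_mem_segment ℝ x y) (right_mem_segment ℝ x y)
  · rw [pow_two, ← mul_assoc]; exact this
  · gcongr
    obtain ⟨θ, hθ, rfl⟩ := (segment_eq_image' ℝ x y) ▸ hz
    rw [add_sub_cancel_left, norm_smul, Real.norm_of_nonneg hθ.1]
    exact mul_le_of_le_one_left (norm_nonneg _) hθ.2

/-- The rays `t ↦ u t x` of the overdetermined system `Dφ = A ∘ φ` fit together into a solution
when the integrability condition holds. -/
lemma norm_ray_sub_le {A : E → F →L[ℝ] E} {A' : E → E →L[ℝ] F →L[ℝ] E} {s : Set E}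
    (hs : Convex ℝ s) {K : ℝ} (hK : 1 ≤ K)
    (hA : ∀ y ∈ s, HasFDerivAt A (A' y) y) (hAK : ∀ y ∈ s, ‖A y‖ ≤ K)
    (hA'K : ∀ y ∈ s, ‖A' y‖ ≤ K)
    (hl : ∀ y ∈ s, ∀ z ∈ s, ‖A' y - A' z‖ ≤ K * ‖y - z‖)
    (hsymm : ∀ y ∈ s, ∀ v w, A' y (A y v) w = A' y (A y w) v)
    {x h : F} (hx : ‖x‖ ≤ 1) {u v : ℝ → E} (hus : ∀ t, u t ∈ s) (hvs : ∀ t, v t ∈ s)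
    (huv : u 0 = v 0)
    (hu : ∀ t ∈ Icc (0 : ℝ) 1, HasDerivWithinAt u (A (u t) x) (Icc 0 1) t)
    (hv : ∀ t ∈ Icc (0 : ℝ) 1, HasDerivWithinAt v (A (v t) (x + h)) (Icc 0 1) t) :
    ‖v 1 - u 1 - A (u 1) h‖ ≤
      (K * (K * Real.exp K) ^ 2 + K * (K * Real.exp K)) * Real.exp K * ‖h‖ ^ 2 := by
  have hK0 : 0 ≤ K := zero_le_one.trans hK
  have hlipA : ∀ y ∈ s, ∀ z ∈ s, ‖A y - A z‖ ≤ K * ‖y - z‖ := fun y hy z hz ↦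
    hs.norm_image_sub_le_of_norm_hasFDerivWithin_le
      (fun w hw ↦ (hA w hw).hasFDerivWithinAt) hA'K hz hy
  set c : ℝ := K * Real.exp K with hc
  have hc0 : 0 ≤ c := by positivity
  -- The velocities differ by `(A v - A u) x + A v h`, so Grönwall bounds the distance of the two
  -- rays linearly in `h`.
  have hd : ∀ t ∈ Icc (0 : ℝ) 1, ‖v t - u t‖ ≤ c * ‖h‖ := by
    intro t ht
    have := norm_le_mul_exp_of_deriv_le (f := fun t ↦ v t - u t)
      (f' := fun t ↦ A (v t) (x + h) - A (u t) x) hK (ε := K * ‖h‖) (by positivity)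
      (fun t ht ↦ (hv t ht).sub (hu t ht)) (by simp [huv]) (fun t ht ↦ ?_) ht
    · calc _ ≤ _ := this
        _ = _ := by rw [hc]; ring
    · have e : A (v t) (x + h) - A (u t) x = (A (v t) - A (u t)) x + A (v t) h := by
        simp only [map_add, sub_apply]; abel
      rw [e]
      refine (norm_add_le _ _).trans (add_le_add ?_ ?_)
      · calc _ ≤ ‖A (v t) - A (u t)‖ * ‖x‖ := ContinuousLinearMap.le_opNorm _ _
          _ ≤ (K * ‖v t - u t‖) * 1 := by
            gcongr
            exact hlipA _ (hvs t) _ (hus t)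
          _ = _ := mul_one _
      · exact (ContinuousLinearMap.le_opNorm _ _).trans (by gcongr; exact hAK _ (hvs t))
  -- If `u t = φ (t x)` for a solution `φ`, moving `x` by `h` moves `u t` by `t • A (u t) h` to
  -- first order. The defect from this prediction obeys a Grönwall inequality whose forcing term is
  -- quadratic in `h`.
  have key := norm_le_mul_exp_of_deriv_le (f := fun t ↦ v t - u t - t • A (u t) h)
    (f' := fun t ↦ A (v t) (x + h) - A (u t) x - (t • A' (u t) (A (u t) x) h + (1 : ℝ) • A (u t) h))
    hK (ε := (K * c ^ 2 + K * c) * ‖h‖ ^ 2) (by positivity) (fun t ht ↦ ?_) (by simp [huv])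
    (fun t ht ↦ ?_) (right_mem_Icc.mpr zero_le_one)
  · rw [one_smul] at key
    calc _ ≤ _ := key
      _ = _ := by ring
  · refine ((hv t ht).sub (hu t ht)).sub ?_
    have h1 : HasDerivWithinAt (fun t ↦ A (u t)) (A' (u t) (A (u t) x)) (Icc 0 1) t :=
      (hA _ (hus t)).comp_hasDerivWithinAt t (hu t ht)
    have h2 : HasDerivWithinAt (fun t ↦ A (u t) h) (A' (u t) (A (u t) x) h) (Icc 0 1) t := by
      simpa using h1.clm_apply (hasDerivWithinAt_const t (Icc (0 : ℝ) 1) h)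
    exact (hasDerivWithinAt_id t _).smul h2
  · have e : A (v t) (x + h) - A (u t) x - (t • A' (u t) (A (u t) x) h + (1 : ℝ) • A (u t) h) =
        A' (u t) (v t - u t - t • A (u t) h) x +
        ((A (v t) - A (u t) - A' (u t) (v t - u t)) x + (A (v t) - A (u t)) h) := by
      -- Integrability exchanges `x` and `h`, so that this term merges with the linearization of `A
      -- v - A u` into `A'` applied to the defect.
      rw [hsymm _ (hus t) x h]
      simp only [map_add, map_sub, map_smul, sub_apply,
        smul_apply, one_smul]
      abel
    rw [e]
    refine (norm_add_le _ _).trans (add_le_add ?_ ((norm_add_le _ _).trans ?_))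
    · calc _ ≤ ‖A' (u t) (v t - u t - t • A (u t) h)‖ * ‖x‖ := ContinuousLinearMap.le_opNorm _ _
        _ ≤ (K * ‖v t - u t - t • A (u t) h‖) * 1 := by
          gcongr
          exact (ContinuousLinearMap.le_opNorm _ _).trans (by gcongr; exact hA'K _ (hus t))
        _ = _ := mul_one _
    · rw [add_mul]
      have h3 := hd t ht
      refine add_le_add ?_ ?_
      · calc _ ≤ ‖A (v t) - A (u t) - A' (u t) (v t - u t)‖ * ‖x‖ :=
            ContinuousLinearMap.le_opNorm _ _
          _ ≤ (K * ‖v t - u t‖ ^ 2) * 1 := by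
            gcongr
            exact norm_taylor_le hs hK0 hA hl (hus t) (hvs t)
          _ ≤ (K * (c * ‖h‖) ^ 2) * 1 := by gcongr
          _ = _ := by ring
      · calc _ ≤ ‖A (v t) - A (u t)‖ * ‖h‖ := ContinuousLinearMap.le_opNorm _ _
          _ ≤ (K * (c * ‖h‖)) * ‖h‖ := by
            gcongr
            exact (hlipA _ (hvs t) _ (hus t)).trans (by gcongr)
          _ = _ := by ring

/-- **Local solvability of total differential equations**: if `A` is smooth near `x₀` and
satisfies the integrability condition there, then `Dφ = A ∘ φ`, `φ 0 = x₀` has a solution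
around `0`. -/
lemma exists_hasFDerivAt_of_symm [CompleteSpace E] {A : E → F →L[ℝ] E} {x₀ : E}
    (hA : ContDiffAt ℝ 2 A x₀)
    (hsymm : ∀ᶠ y in 𝓝 x₀, ∀ v w, fderiv ℝ A y (A y v) w = fderiv ℝ A y (A y w) v)
    {s : Set E} (hs : s ∈ 𝓝 x₀) :
    ∃ φ : F → E, φ 0 = x₀ ∧ ∃ δ > 0, ∀ x ∈ ball (0 : F) δ, φ x ∈ s ∧
      HasFDerivAt φ (A (φ x)) x := by
  obtain ⟨K₁, t, ht, hlip⟩ :=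
    (hA.fderiv_right (m := 1) (by norm_num)).exists_lipschitzOnWith
  have hdiff : ∀ᶠ y in 𝓝 x₀, DifferentiableAt ℝ A y :=
    (hA.eventually (by simp)).mono fun y hy ↦ hy.differentiableAt (by simp)
  have hbA : ∀ᶠ y in 𝓝 x₀, ‖A y‖ < ‖A x₀‖ + 1 :=
    hA.continuousAt.norm.eventually (gt_mem_nhds (lt_add_one _))
  have hbA' : ∀ᶠ y in 𝓝 x₀, ‖fderiv ℝ A y‖ < ‖fderiv ℝ A x₀‖ + 1 :=
    (hA.fderiv_right (m := 1) (by norm_num)).continuousAt.norm.eventually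
      (gt_mem_nhds (lt_add_one _))
  obtain ⟨a, ha, hball⟩ := nhds_basis_closedBall.eventually_iff.mp
    (hsymm.and (hdiff.and (hbA.and (hbA'.and ((eventually_mem_set.mpr ht).and
      (eventually_mem_set.mpr hs))))))
  -- One constant bounds `A`, its derivative and the Lipschitz constant of that derivative. The
  -- summand `+ 1` also makes it at least `1`, as the Grönwall estimate requires.
  set K : ℝ := max (max (‖A x₀‖ + 1) (‖fderiv ℝ A x₀‖ + 1)) K₁ with hKdef
  have hK : 1 ≤ K := by
    refine le_trans ?_ ((le_max_left _ _).trans (le_max_left _ _))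
    linarith [norm_nonneg (A x₀)]
  have hconv := convex_closedBall x₀ a
  have hd' : ∀ y ∈ closedBall x₀ a, HasFDerivAt A (fderiv ℝ A y) y := fun y hy ↦
    (hball hy).2.1.hasFDerivAt
  have hAK : ∀ y ∈ closedBall x₀ a, ‖A y‖ ≤ K := fun y hy ↦
    (hball hy).2.2.1.le.trans ((le_max_left _ _).trans (le_max_left _ _))
  have hA'K : ∀ y ∈ closedBall x₀ a, ‖fderiv ℝ A y‖ ≤ K := fun y hy ↦
    (hball hy).2.2.2.1.le.trans ((le_max_right _ _).trans (le_max_left _ _))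
  have hl : ∀ y ∈ closedBall x₀ a, ∀ z ∈ closedBall x₀ a,
      ‖fderiv ℝ A y - fderiv ℝ A z‖ ≤ K * ‖y - z‖ := fun y hy z hz ↦
    (hlip.norm_sub_le (hball hy).2.2.2.2.1 (hball hz).2.2.2.2.1).trans
      (by gcongr; exact le_max_right _ _)
  have hK0 : 0 < K := zero_lt_one.trans_le hK
  -- A speed of at most `K * ‖x‖ ≤ a` keeps the ray in the ball up to time `1`, while `‖x‖ ≤ 1`
  -- makes `K` a Lipschitz constant of its equation.
  have hray : ∀ x : F, ‖x‖ < min 1 (a / K) → ∃ u : ℝ → E, u 0 = x₀ ∧ (∀ t, u t ∈ closedBall x₀ a) ∧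
      ∀ t ∈ Icc (0 : ℝ) 1, HasDerivWithinAt u (A (u t) x) (Icc 0 1) t := by
    intro x hx
    have hx1 : ‖x‖ ≤ 1 := hx.le.trans (min_le_left _ _)
    have hpl : IsPicardLindelof (fun _ y ↦ A y x) (tmin := 0) (tmax := 1)
        ⟨0, left_mem_Icc.mpr zero_le_one⟩ x₀ ⟨a, ha.le⟩ 0 ⟨K * ‖x‖, by positivity⟩ ⟨K, hK0.le⟩ := by
      refine IsPicardLindelof.of_time_independent (fun y hy ↦ ?_) ?_ ?_
      · exact (ContinuousLinearMap.le_opNorm _ _).trans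
          (mul_le_mul_of_nonneg_right (hAK y hy) (norm_nonneg _))
      · refine LipschitzOnWith.of_dist_le_mul fun y hy z hz ↦ ?_
        rw [dist_eq_norm, dist_eq_norm, ← sub_apply]
        have h1 : ‖A y - A z‖ ≤ K * ‖y - z‖ :=
          hconv.norm_image_sub_le_of_norm_hasFDerivWithin_le
            (fun w hw ↦ (hd' w hw).hasFDerivWithinAt) hA'K hz hy
        calc _ ≤ ‖A y - A z‖ * ‖x‖ := ContinuousLinearMap.le_opNorm _ _
          _ ≤ (K * ‖y - z‖) * 1 := by gcongr
          _ = _ := mul_one _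
      · have : K * ‖x‖ ≤ a := by
          have := hx.le.trans (min_le_right _ _)
          rwa [le_div_iff₀ hK0, mul_comm] at this
        change K * ‖x‖ * max ((1 : ℝ) - 0) (0 - 0) ≤ a - 0
        simpa using this
    exact exists_mem_closedBall_hasDerivWithinAt hpl (mem_closedBall_self le_rfl)
  choose! u hu0 hus hu using hray
  have hδ : 0 < min 1 (a / K) := lt_min one_pos (by positivity)
  -- The solution sends `x` to the endpoint of its ray. For `x = 0` the velocity is zero and
  -- Grönwall with `ε = 0` keeps the ray at `x₀`.
  refine ⟨fun x ↦ u x 1, ?_, min 1 (a / K), hδ, fun x hx ↦ ?_⟩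
  · have h0 : ‖(0 : F)‖ < min 1 (a / K) := by simpa using hδ
    have := norm_le_mul_exp_of_deriv_le (f := fun t ↦ u 0 t - x₀) (f' := fun t ↦ A (u 0 t) 0)
      le_rfl le_rfl (fun t ht ↦ (hu 0 h0 t ht).sub_const x₀) (by simp [hu0 0 h0])
      (fun t ht ↦ by simp) (right_mem_Icc.mpr zero_le_one)
    rw [zero_mul] at this
    exact sub_eq_zero.mp (norm_le_zero_iff.mp this)
  rw [mem_ball_zero_iff] at hx
  refine ⟨(hball (hus x hx 1)).2.2.2.2.2, ?_⟩
  rw [hasFDerivAt_iff_isLittleO_nhds_zero]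
  refine Asymptotics.IsBigO.trans_isLittleO (g := fun h : F ↦ ‖h‖ ^ 2) ?_ ?_
  · refine Asymptotics.IsBigO.of_bound
      ((K * (K * Real.exp K) ^ 2 + K * (K * Real.exp K)) * Real.exp K) ?_
    have hev : ∀ᶠ h : F in 𝓝 0, ‖x + h‖ < min 1 (a / K) := by
      have : ContinuousAt (fun h : F ↦ ‖x + h‖) 0 := by fun_prop
      exact this.eventually (gt_mem_nhds (by simpa using hx))
    filter_upwards [hev] with h hh
    rw [Real.norm_of_nonneg (by positivity)]
    exact norm_ray_sub_le hconv hK hd' hAK hA'K hl (fun y hy ↦ (hball hy).1)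
      (hx.le.trans (min_le_left _ _)) (hus x hx) (hus _ hh) ((hu0 x hx).trans (hu0 _ hh).symm)
      (hu x hx) (hu _ hh)
  · exact Asymptotics.isLittleO_norm_pow_id one_lt_two

/-- Bootstrap: a solution of `Dφ = A ∘ φ` with `A` smooth is smooth. -/
lemma contDiffOn_of_hasFDerivAt_comp {A : E → F →L[ℝ] E} {s : Set E}
    (hA : ContDiffOn ℝ ∞ A s) {φ : F → E} {U : Set F} (hU : IsOpen U)
    (hφ : ∀ x ∈ U, φ x ∈ s ∧ HasFDerivAt φ (A (φ x)) x) : ContDiffOn ℝ ∞ φ U := by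
  rw [contDiffOn_infty]
  intro n
  induction n with
  | zero => exact contDiffOn_zero.mpr fun x hx ↦ (hφ x hx).2.continuousAt.continuousWithinAt
  | succ n ih =>
    rw [Nat.cast_succ, contDiffOn_succ_iff_fderiv_of_isOpen hU]
    refine ⟨fun x hx ↦ (hφ x hx).2.differentiableAt.differentiableWithinAt, by simp, ?_⟩
    -- The derivative `A ∘ φ` is as regular as `φ`, so each round gains one order.
    have : ContDiffOn ℝ n (fun x ↦ A (φ x)) U :=
      (hA.of_le (by exact_mod_cast le_top)).comp ih fun x hx ↦ (hφ x hx).1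
    exact this.congr fun x hx ↦ (hφ x hx).2.fderiv

end Rays

end

/-! ### Frobenius' theorem for ranges of projector fields -/

section Projectors

variable {V F : Type*} [NormedAddCommGroup V] [NormedSpace ℝ V]
  [NormedAddCommGroup F] [NormedSpace ℝ F]

/-- The derivative of a projector field is symmetric on the tangent spaces of an integral
manifold. -/
lemma fderiv_projector_symm_of_integral {E : V → V →L[ℝ] V} {φ : F → V} {u : F}
    (hE : DifferentiableAt ℝ E (φ u)) (hφ : ContDiffAt ℝ 2 φ u)
    (h : ∀ᶠ x in 𝓝 u, ∀ v, E (φ x) (fderiv ℝ φ x v) = fderiv ℝ φ x v) (v w : F) :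
    fderiv ℝ E (φ u) (fderiv ℝ φ u v) (fderiv ℝ φ u w) =
      fderiv ℝ E (φ u) (fderiv ℝ φ u w) (fderiv ℝ φ u v) := by
  have hd : HasFDerivAt φ (fderiv ℝ φ u) u := (hφ.differentiableAt (by simp)).hasFDerivAt
  have hd2 : HasFDerivAt (fderiv ℝ φ) (fderiv ℝ (fderiv ℝ φ) u) u :=
    ((hφ.fderiv_right (m := 1) (by norm_num)).differentiableAt (by simp)).hasFDerivAt
  -- Differentiating `E(φ) (Dφ v) = Dφ v` along `w` expresses the left side through the second
  -- derivative of `φ`, which is symmetric.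
  have key : ∀ v w, fderiv ℝ E (φ u) (fderiv ℝ φ u w) (fderiv ℝ φ u v) =
      fderiv ℝ (fderiv ℝ φ) u w v - E (φ u) (fderiv ℝ (fderiv ℝ φ) u w v) := by
    intro v w
    have h1 : HasFDerivAt (fun x ↦ fderiv ℝ φ x v) _ u := hd2.clm_apply (hasFDerivAt_const v u)
    have h2 : HasFDerivAt (fun x ↦ E (φ x) (fderiv ℝ φ x v)) _ u :=
      (hE.hasFDerivAt.comp u hd).clm_apply h1
    have h3 := h2.unique (h1.congr_of_eventuallyEq (h.mono fun x hx ↦ hx v))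
    have h4 := congrArg (fun L ↦ L w) h3
    simp at h4
    exact eq_sub_of_add_eq' h4
  have hs : IsSymmSndFDerivAt ℝ φ u := hφ.isSymmSndFDerivAt (by simp)
  rw [key, key, hs.eq]

/-- **Frobenius' theorem** for the distribution of the ranges of a smooth field of projectors. -/
theorem exists_integral_manifold_of_fderiv_projector_symm [FiniteDimensional ℝ V]
    {E : V → V →L[ℝ] V} {Ω : Set V} (hΩ : IsOpen Ω) (hE : ContDiffOn ℝ ∞ E Ω)
    (hidem : ∀ y ∈ Ω, ∀ v, E y (E y v) = E y v)
    (hsymm : ∀ y ∈ Ω, ∀ a b, E y a = a → E y b = b → fderiv ℝ E y a b = fderiv ℝ E y b a)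
    {x₀ : V} (hx₀ : x₀ ∈ Ω) :
    ∃ (r : ℕ) (U : Set (EuclideanSpace ℝ (Fin r))) (φ : EuclideanSpace ℝ (Fin r) → V),
      IsOpen U ∧ 0 ∈ U ∧ φ 0 = x₀ ∧ ContDiffOn ℝ ∞ φ U ∧ ∀ u ∈ U, φ u ∈ Ω ∧
        Function.Injective (fderiv ℝ φ u) ∧
        LinearMap.range (fderiv ℝ φ u).toLinearMap = LinearMap.range (E (φ u)).toLinearMap := by
  have : CompleteSpace V := FiniteDimensional.complete ℝ V
  set R := LinearMap.range (E x₀).toLinearMap with hR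
  let F := EuclideanSpace ℝ (Fin (Module.finrank ℝ R))
  let e : F ≃L[ℝ] R := ContinuousLinearEquiv.ofFinrankEq (by simp [F])
  let ι : F →L[ℝ] V := R.subtypeL.comp e.toContinuousLinearMap
  let pr : V →L[ℝ] F := e.symm.toContinuousLinearMap.comp
    ((E x₀).codRestrict R fun v ↦ ⟨v, rfl⟩)
  have hpr0 : ∀ v, pr v = 0 → E x₀ v = 0 := fun v hv ↦ by
    have := e.symm.map_eq_zero_iff.mp hv
    exact congrArg Subtype.val this
  have hE0 : ∀ v ∈ R, E x₀ v = v := by rintro _ ⟨v, rfl⟩; exact hidem _ hx₀ v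
  let T : V → F →L[ℝ] F := fun y ↦ pr.comp ((E y).comp ι)
  have hT0 : T x₀ = 1 := by
    ext1 v
    have h : (⟨E x₀ (E x₀ (e v)), (⟨_, rfl⟩ : E x₀ (E x₀ (e v)) ∈ R)⟩ : R) = e v :=
      Subtype.ext ((hidem _ hx₀ _).trans (hE0 _ (e v).2))
    exact (congrArg e.symm h).trans (e.symm_apply_apply v)
  -- `A y` is the frame of the range of `E y` normalized by `pr (A y v) = v`, which presents the
  -- integral manifold as a graph over the range of `E x₀`.
  let A : V → F →L[ℝ] V := fun y ↦ ((E y).comp ι).comp (Ring.inverse (T y))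
  have hEat : ContDiffAt ℝ ∞ E x₀ := hE.contDiffAt (hΩ.mem_nhds hx₀)
  have hTsm : ∀ y, ContDiffAt ℝ ∞ E y → ContDiffAt ℝ ∞ T y := fun y hy ↦
    contDiffAt_const.clm_comp (hy.clm_comp contDiffAt_const)
  have hunit : ∀ᶠ y in 𝓝 x₀, IsUnit (T y) :=
    (hTsm _ hEat).continuousAt.eventually
      (Units.isOpen.mem_nhds (by rw [hT0]; exact isUnit_one))
  have hnear : ∀ᶠ y in 𝓝 x₀, ‖E y - E x₀‖ < 1 := by
    have : ContinuousAt (fun y ↦ ‖E y - E x₀‖) x₀ :=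
      (hEat.continuousAt.sub continuousAt_const).norm
    exact this.eventually (gt_mem_nhds (by simp))
  obtain ⟨s, hs, hso, hxs⟩ := eventually_nhds_iff.mp
    (hunit.and (hnear.and (hΩ.eventually_mem hx₀)))
  have hEs : ∀ y ∈ s, ContDiffAt ℝ ∞ E y := fun y hy ↦ hE.contDiffAt (hΩ.mem_nhds (hs y hy).2.2)
  have hAsm : ∀ y ∈ s, ContDiffAt ℝ ∞ A y := by
    intro y hy
    refine ((hEs y hy).clm_comp contDiffAt_const).clm_comp ?_
    obtain ⟨t, ht⟩ := (hs y hy).1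
    exact ContDiffAt.comp y (ht ▸ contDiffAt_ringInverse ℝ t) (hTsm y (hEs y hy))
  have hprA : ∀ y ∈ s, ∀ v, pr (A y v) = v := fun y hy v ↦ by
    have := Ring.mul_inverse_cancel _ (hs y hy).1
    exact congrArg (fun L ↦ L v) this
  have hEA : ∀ y ∈ s, ∀ v, E y (A y v) = A y v := fun y hy v ↦ hidem y (hs y hy).2.2 _
  -- If `pr v = 0` then `E x₀ v = 0`, so `E y - E x₀`, of norm less than `1`, would fix `v`.
  have hinj : ∀ y ∈ s, ∀ v, E y v = v → pr v = 0 → v = 0 := by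
    intro y hy v hv hprv
    by_contra hne
    have h1 : (E y - E x₀) v = v := by rw [sub_apply, hv, hpr0 v hprv, sub_zero]
    have h2 := (E y - E x₀).le_opNorm v
    rw [h1] at h2
    have h3 := norm_pos_iff.mpr hne
    nlinarith [(hs y hy).2.1]
  have hcomm : ∀ y ∈ s, ∀ v w, fderiv ℝ A y (A y v) w = fderiv ℝ A y (A y w) v := by
    intro y hy v w
    have hA' : HasFDerivAt A (fderiv ℝ A y) y :=
      ((hAsm y hy).differentiableAt (by simp)).hasFDerivAt
    have hE' : HasFDerivAt E (fderiv ℝ E y) y :=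
      ((hEs y hy).differentiableAt (by simp)).hasFDerivAt
    have hAv : ∀ v, HasFDerivAt (fun z ↦ A z v) ((fderiv ℝ A y).flip v) y := fun v ↦ by
      convert hA'.clm_apply (hasFDerivAt_const v y) using 1
      ext; simp
    -- Differentiating `E A = A` and `pr A = id` shows that the antisymmetric part of `DA` lies in
    -- the range of `E y` and is killed by `pr`. It therefore vanishes by `hinj`.
    have h1 : ∀ a v, fderiv ℝ E y a (A y v) + E y (fderiv ℝ A y a v) = fderiv ℝ A y a v := by
      intro a v
      have := (hE'.clm_apply (hAv v)).unique ((hAv v).congr_of_eventuallyEq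
        (eventually_of_mem (hso.mem_nhds hy) fun z hz ↦ hEA z hz v))
      have := congrArg (fun L ↦ L a) this
      simp at this
      rwa [add_comm]
    have h2 : ∀ a v, pr (fderiv ℝ A y a v) = 0 := by
      intro a v
      have := (pr.hasFDerivAt.comp y (hAv v)).unique ((hasFDerivAt_const v y).congr_of_eventuallyEq
        (eventually_of_mem (hso.mem_nhds hy) fun z hz ↦ hprA z hz v))
      exact congrArg (fun L ↦ L a) this
    refine sub_eq_zero.mp (hinj y hy _ ?_ ?_)
    · have h3 := hsymm y (hs y hy).2.2 _ _ (hEA y hy v) (hEA y hy w)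
      have h4 := h1 (A y v) w
      have h5 := h1 (A y w) v
      rw [map_sub, eq_sub_of_add_eq' h4, eq_sub_of_add_eq' h5, h3]
      abel
    · rw [map_sub, h2, h2, sub_zero]
  obtain ⟨φ, hφ0, δ, hδ, hφ⟩ := exists_hasFDerivAt_of_symm (A := A) (x₀ := x₀)
    (contDiffAt_infty.mp (hAsm x₀ hxs) 2)
    (eventually_of_mem (hso.mem_nhds hxs) hcomm) (hso.mem_nhds hxs)
  refine ⟨_, Metric.ball 0 δ, φ, Metric.isOpen_ball, Metric.mem_ball_self hδ, hφ0,
    contDiffOn_of_hasFDerivAt_comp (s := s) (fun y hy ↦ (hAsm y hy).contDiffWithinAt)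
      Metric.isOpen_ball hφ, fun u hu ↦ ?_⟩
  obtain ⟨hus, hd⟩ := hφ u hu
  rw [hd.fderiv]
  refine ⟨(hs _ hus).2.2, Function.LeftInverse.injective (hprA _ hus), le_antisymm ?_ ?_⟩
  · rintro _ ⟨v, rfl⟩
    exact ⟨_, hEA _ hus v⟩
  · rintro _ ⟨v, rfl⟩
    -- A vector in the range of `E (φ u)` is determined by its image under `pr`, and `A (φ u)`
    -- recovers it from there.
    refine ⟨pr (E (φ u) v), (sub_eq_zero.mp (hinj _ hus _ ?_ ?_)).symm⟩
    · change E (φ u) (E (φ u) v - A (φ u) _) = E (φ u) v - A (φ u) _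
      rw [map_sub, hidem _ (hs _ hus).2.2, hEA _ hus]
    · change pr (E (φ u) v - A (φ u) _) = 0
      rw [map_sub, hprA _ hus, sub_self]

end Projectors

/-! ### Spectral projectors as Lagrange products -/

/-- An endomorphism which is self-adjoint for a positive definite form is diagonalizable. -/
lemma iSup_eigenspace_eq_top_of_selfAdjoint {V : Type*} [AddCommGroup V] [Module ℝ V]
    [FiniteDimensional ℝ V] (B : V →ₗ[ℝ] V →ₗ[ℝ] ℝ) (hB : ∀ v w, B v w = B w v)
    (hpos : ∀ v, 0 ≤ B v v) (hdef : ∀ v, B v v = 0 → v = 0) (T : Module.End ℝ V)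
    (hT : ∀ v w, B (T v) w = B v (T w)) : ⨆ μ, Module.End.eigenspace T μ = ⊤ := by
  let core : InnerProductSpace.Core ℝ V :=
    { inner := fun v w ↦ B v w
      conj_inner_symm := fun v w ↦ hB w v
      re_inner_nonneg := hpos
      add_left := fun u v w ↦ by simp
      smul_left := fun u v r ↦ by simp
      definite := hdef }
  let _ : NormedAddCommGroup V := core.toNormedAddCommGroup
  let _ : InnerProductSpace ℝ V := InnerProductSpace.ofCore core.toCore
  have h : T.IsSymmetric := fun v w ↦ hT v w
  rw [← Submodule.orthogonal_eq_bot_iff]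
  exact h.orthogonalComplement_iSup_eigenspaces_eq_bot

section EigenProj

variable {V W : Type*} [AddCommGroup V] [Module ℝ V] [TopologicalSpace V]
  [IsTopologicalAddGroup V] [ContinuousConstSMul ℝ V]
  [AddCommGroup W] [Module ℝ W] [TopologicalSpace W]
  [IsTopologicalAddGroup W] [ContinuousConstSMul ℝ W] {k : ℕ}

/-- The product of the operators `(μ i - μ j)⁻¹ (T - μ j)` over a list of indices `j`. -/
def eigenProd (T : V →L[ℝ] V) (μ : Fin (k + 1) → ℝ) (i : Fin (k + 1)) :
    List (Fin (k + 1)) → V →L[ℝ] V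
  | [] => ContinuousLinearMap.id ℝ V
  | j :: L => ((μ i - μ j)⁻¹ • (T - μ j • ContinuousLinearMap.id ℝ V)).comp (eigenProd T μ i L)

lemma eigenProd_nil_apply (T : V →L[ℝ] V) (μ : Fin (k + 1) → ℝ) (i : Fin (k + 1)) (v : V) :
    eigenProd T μ i [] v = v := rfl

lemma eigenProd_cons_apply (T : V →L[ℝ] V) (μ : Fin (k + 1) → ℝ) (i j : Fin (k + 1))
    (L : List (Fin (k + 1))) (v : V) :
    eigenProd T μ i (j :: L) v =
      (μ i - μ j)⁻¹ • (T (eigenProd T μ i L v) - μ j • eigenProd T μ i L v) := rfl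

lemma eigenProd_apply_of_eigen {T : V →L[ℝ] V} {μ : Fin (k + 1) → ℝ} (i : Fin (k + 1)) {c : ℝ}
    {v : V} (hv : T v = c • v) (L : List (Fin (k + 1))) :
    eigenProd T μ i L v = (L.map fun j ↦ (c - μ j) / (μ i - μ j)).prod • v := by
  induction L with
  | nil => simp [eigenProd_nil_apply]
  | cons j L ih =>
    rw [eigenProd_cons_apply, ih, map_smul, hv, List.map_cons, List.prod_cons]
    module

/-- The product is built from the operator by linear operations and composition, so intertwining
passes to it. With `A` the differential of a chart, this identifies the projector read in
coordinates. -/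
lemma eigenProd_intertwine {T : V →L[ℝ] V} {T' : W →L[ℝ] W} {A : V → W}
    (hadd : ∀ v w, A (v - w) = A v - A w) (hsmul : ∀ (c : ℝ) v, A (c • v) = c • A v)
    (h : ∀ v, T' (A v) = A (T v)) (μ : Fin (k + 1) → ℝ) (i : Fin (k + 1))
    (L : List (Fin (k + 1))) (v : V) : eigenProd T' μ i L (A v) = A (eigenProd T μ i L v) := by
  induction L with
  | nil => rfl
  | cons j L ih => rw [eigenProd_cons_apply, eigenProd_cons_apply, ih, h, hsmul, hadd, hsmul]

/-- The spectral projector of a diagonalizable endomorphism with the eigenvalues `μ`, for the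
eigenvalue `μ i`. -/
def eigenProj (T : V →L[ℝ] V) (μ : Fin (k + 1) → ℝ) (i : Fin (k + 1)) : V →L[ℝ] V :=
  eigenProd T μ i ((List.finRange (k + 1)).filter (· ≠ i))

lemma eigenProj_apply_of_eigen {T : V →L[ℝ] V} {μ : Fin (k + 1) → ℝ}
    (hμ : Function.Injective μ) {i : Fin (k + 1)} {v : V} (hv : T v = μ i • v) :
    eigenProj T μ i v = v := by
  rw [eigenProj, eigenProd_apply_of_eigen i hv, List.prod_eq_one, one_smul]
  intro x hx
  obtain ⟨j, hj, rfl⟩ := List.mem_map.mp hx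
  have hne : j ≠ i := by simpa using (List.mem_filter.mp hj).2
  exact div_self (sub_ne_zero.mpr (hμ.ne hne.symm))

lemma eigenProj_apply_of_eigen_ne {T : V →L[ℝ] V} {μ : Fin (k + 1) → ℝ} {i j : Fin (k + 1)}
    (hij : j ≠ i) {v : V} (hv : T v = μ j • v) : eigenProj T μ i v = 0 := by
  rw [eigenProj, eigenProd_apply_of_eigen i hv, List.prod_eq_zero, zero_smul]
  exact List.mem_map.mpr ⟨j, List.mem_filter.mpr ⟨List.mem_finRange j, by simpa using hij⟩,
    by simp⟩

/-- Diagonalizability reduces the claim to eigenvectors, on which the product acts as the identity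
for `μ i` and as zero for the other eigenvalues. -/
lemma apply_eigenProj {T : V →L[ℝ] V} {μ : Fin (k + 1) → ℝ} (hμ : Function.Injective μ)
    (hspec : ∀ c, Module.End.HasEigenvalue T.toLinearMap c → ∃ j, μ j = c)
    (htop : ⨆ c, Module.End.eigenspace T.toLinearMap c = ⊤) (i : Fin (k + 1)) (v : V) :
    T (eigenProj T μ i v) = μ i • eigenProj T μ i v := by
  have h : (⨆ c, Module.End.eigenspace T.toLinearMap c) ≤
      (Module.End.eigenspace T.toLinearMap (μ i)).comap (eigenProj T μ i).toLinearMap := by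
    refine iSup_le fun c w hw ↦ ?_
    change eigenProj T μ i w ∈ Module.End.eigenspace T.toLinearMap (μ i)
    have hw' : T w = c • w := Module.End.mem_eigenspace_iff.mp hw
    by_cases h0 : w = 0
    · rw [h0, map_zero]; exact zero_mem _
    obtain ⟨j, rfl⟩ := hspec c (Module.End.hasEigenvalue_of_hasEigenvector ⟨hw, h0⟩)
    by_cases hij : j = i
    · subst hij
      rw [eigenProj_apply_of_eigen hμ hw']
      exact hw
    · rw [eigenProj_apply_of_eigen_ne hij hw']
      exact zero_mem _
  exact Module.End.mem_eigenspace_iff.mp (h (htop ▸ Submodule.mem_top : v ∈ _))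

end EigenProj

/-- Since `i` is absent from the list and the eigenvalues stay distinct, no denominator vanishes. -/
lemma ContDiffOn.eigenProd {V F : Type*} [NormedAddCommGroup V] [NormedSpace ℝ V]
    [NormedAddCommGroup F] [NormedSpace ℝ F] {k : ℕ} {T : F → V →L[ℝ] V}
    {μ : Fin (k + 1) → F → ℝ} {s : Set F} (hT : ContDiffOn ℝ ∞ T s)
    (hμ : ∀ j, ContDiffOn ℝ ∞ (μ j) s) (hinj : ∀ x ∈ s, Function.Injective fun j ↦ μ j x)
    {i : Fin (k + 1)} {L : List (Fin (k + 1))} (hL : ∀ j ∈ L, j ≠ i) :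
    ContDiffOn ℝ ∞ (fun x ↦ _root_.eigenProd (T x) (fun j ↦ μ j x) i L) s := by
  induction L with
  | nil => exact contDiffOn_const
  | cons j L ih =>
    have h1 : ContDiffOn ℝ ∞ (fun x ↦ (μ i x - μ j x)⁻¹) s :=
      ((hμ i).sub (hμ j)).inv fun x hx ↦
        sub_ne_zero.mpr ((hinj x hx).ne (hL j List.mem_cons_self).symm)
    have h2 : ContDiffOn ℝ ∞ (fun x ↦ T x - μ j x • ContinuousLinearMap.id ℝ V) s :=
      hT.sub ((hμ j).smul contDiffOn_const)
    exact (h1.smul h2).clm_comp (ih fun m hm ↦ hL m (List.mem_cons_of_mem _ hm))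

lemma ContDiffOn.eigenProj {V F : Type*} [NormedAddCommGroup V] [NormedSpace ℝ V]
    [NormedAddCommGroup F] [NormedSpace ℝ F] {k : ℕ} {T : F → V →L[ℝ] V}
    {μ : Fin (k + 1) → F → ℝ} {s : Set F} (hT : ContDiffOn ℝ ∞ T s)
    (hμ : ∀ j, ContDiffOn ℝ ∞ (μ j) s) (hinj : ∀ x ∈ s, Function.Injective fun j ↦ μ j x)
    (i : Fin (k + 1)) :
    ContDiffOn ℝ ∞ (fun x ↦ _root_.eigenProj (T x) (fun j ↦ μ j x) i) s :=
  hT.eigenProd hμ hinj fun j hj ↦ by simpa using (List.mem_filter.mp hj).2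

namespace Lightlike

/-! ### Algebra of the Christoffel symbols -/

section Koszul

variable {V : Type*} [NormedAddCommGroup V] [NormedSpace ℝ V]

/-- The Christoffel symbols of the first kind as a function of the derivative of the metric. -/
def koszul (D : V →L[ℝ] V →L[ℝ] V →L[ℝ] ℝ) (u w : V) : V →L[ℝ] ℝ :=
  (2⁻¹ : ℝ) • (D u w + D w u - (D.flip u).flip w)

variable (D : V →L[ℝ] V →L[ℝ] V →L[ℝ] ℝ)

lemma koszul_apply (u w y : V) : koszul D u w y = 2⁻¹ * (D u w y + D w u y - D y u w) := rfl

lemma koszul_add_right (u w w' : V) : koszul D u (w + w') = koszul D u w + koszul D u w' := by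
  ext y
  have h1 := (D u).map_add w w'
  have h2 := D.map_add w w'
  have h3 := (D y u).map_add w w'
  rw [add_apply, koszul_apply, koszul_apply, koszul_apply, h1, h2, h3]
  simp only [add_apply]
  ring

lemma koszul_smul_right (r : ℝ) (u w : V) : koszul D u (r • w) = r • koszul D u w := by
  ext y
  have h1 := (D u).map_smul r w
  have h2 := D.map_smul r w
  have h3 := (D y u).map_smul r w
  rw [smul_apply, koszul_apply, koszul_apply, h1, h2, h3]
  simp only [smul_apply, smul_eq_mul]
  ring

variable {D}

/-- This is the coordinate form of vanishing torsion. -/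
lemma koszul_symm (hD : ∀ a u w, D a u w = D a w u) (u w : V) : koszul D u w = koszul D w u := by
  ext y; rw [koszul_apply, koszul_apply, hD y u w]; ring

/-- The antisymmetric terms cancel. This is the compatibility of the connection with the metric in
coordinates. -/
lemma koszul_add_koszul (hD : ∀ a u w, D a u w = D a w u) (u w y : V) :
    koszul D u w y + koszul D u y w = D u w y := by
  rw [koszul_apply, koszul_apply, hD w u y, hD y u w, hD u y w]
  ring

lemma fderiv_bilin_symm {g : V → V →L[ℝ] V →L[ℝ] ℝ} {x : V} (hg : DifferentiableAt ℝ g x)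
    (hs : ∀ y u w, g y u w = g y w u) (a u w : V) :
    fderiv ℝ g x a u w = fderiv ℝ g x a w u := by
  have h1 : ∀ u w, HasFDerivAt (fun y ↦ g y u w) (((fderiv ℝ g x).flip u).flip w) x := by
    intro u w
    refine ((hg.hasFDerivAt.clm_apply (hasFDerivAt_const u x)).clm_apply
      (hasFDerivAt_const w x)).congr_fderiv ?_
    ext; simp
  exact congrArg (fun L ↦ L a) ((h1 u w).unique
    ((h1 w u).congr_of_eventuallyEq (.of_forall fun y ↦ hs y u w)))

end Koszul

/-! ### Fields, endomorphisms and metrics read in charts -/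

section Charts

variable {m : ℕ} {N : Type*} [TopologicalSpace N]
  [ChartedSpace (EuclideanSpace ℝ (Fin m)) N] [IsManifold (𝓡 m) ∞ N]

/-- The differential of the chart around `c`. -/
def dchart (c q : N) : TangentSpace (𝓡 m) q →L[ℝ] EuclideanSpace ℝ (Fin m) :=
  mfderiv (𝓡 m) 𝓘(ℝ, EuclideanSpace ℝ (Fin m)) (extChartAt (𝓡 m) c) q

/-- The differential of the inverse of the chart around `c`. -/
def dchartSymm (c : N) (z : EuclideanSpace ℝ (Fin m)) :
    EuclideanSpace ℝ (Fin m) →L[ℝ] TangentSpace (𝓡 m) ((extChartAt (𝓡 m) c).symm z) :=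
  mfderiv 𝓘(ℝ, EuclideanSpace ℝ (Fin m)) (𝓡 m) (extChartAt (𝓡 m) c).symm z

/-- A vector field read in the chart around `c`. -/
def chartField (c : N) (X : VField m N) (z : EuclideanSpace ℝ (Fin m)) :
    EuclideanSpace ℝ (Fin m) :=
  dchart c _ (X ((extChartAt (𝓡 m) c).symm z))

variable {c : N} {z : EuclideanSpace ℝ (Fin m)} {q : N}

lemma dchart_dchartSymm (hz : z ∈ (extChartAt (𝓡 m) c).target) (u : EuclideanSpace ℝ (Fin m)) :
    dchart c _ (dchartSymm c z u) = u := by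
  have h := mfderiv_extChartAt_comp_mfderivWithin_extChartAt_symm (I := 𝓡 m) hz
  rw [modelWithCornersSelf_coe, range_id, mfderivWithin_univ] at h
  exact congrArg (fun L ↦ L u) h

lemma dchartSymm_dchart (hz : z ∈ (extChartAt (𝓡 m) c).target)
    (v : TangentSpace (𝓡 m) ((extChartAt (𝓡 m) c).symm z)) :
    dchartSymm c z (dchart c _ v) = v := by
  have h := mfderivWithin_extChartAt_symm_comp_mfderiv_extChartAt (I := 𝓡 m) hz
  rw [modelWithCornersSelf_coe, range_id, mfderivWithin_univ] at h
  exact congrArg (fun L ↦ L v) h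

lemma dchart_isInvertible (hq : q ∈ (extChartAt (𝓡 m) c).source) :
    (dchart (m := m) c q).IsInvertible := isInvertible_mfderiv_extChartAt hq

lemma dchart_injective (hq : q ∈ (extChartAt (𝓡 m) c).source) :
    Function.Injective (dchart (m := m) c q) := (dchart_isInvertible hq).injective

lemma dchart_surjective (hq : q ∈ (extChartAt (𝓡 m) c).source) :
    Function.Surjective (dchart (m := m) c q) := (dchart_isInvertible hq).surjective

/-- Over the chart domain the trivialization of the tangent bundle is the differential of the chart,
so smoothness may be tested on coordinates. -/
lemma contMDiffOn_field_iff {X : VField m N} :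
    SmoothFieldOn X (extChartAt (𝓡 m) c).source ↔
      ContMDiffOn (𝓡 m) 𝓘(ℝ, EuclideanSpace ℝ (Fin m)) ∞ (fun q ↦ dchart c q (X q))
        (extChartAt (𝓡 m) c).source := by
  have hb : (extChartAt (𝓡 m) c).source =
    (trivializationAt (EuclideanSpace ℝ (Fin m)) (TangentSpace (𝓡 m)) c).baseSet := by
      rw [extChartAt_source]; rfl
  rw [SmoothFieldOn, Trivialization.contMDiffOn_section_iff
    (trivializationAt (EuclideanSpace ℝ (Fin m)) (TangentSpace (𝓡 m)) c)
    (isOpen_extChartAt_source c) hb.le]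
  refine contMDiffOn_congr fun q hq ↦ ?_
  have h := TangentBundle.continuousLinearMapAt_trivializationAt (I := 𝓡 m)
    (by rwa [extChartAt_source] at hq : q ∈ (chartAt (EuclideanSpace ℝ (Fin m)) c).source)
  have h2 := congrArg (fun L ↦ L (X q)) h
  rw [dchart]
  refine Eq.trans ?_ h2
  exact (congrFun (Trivialization.coe_linearMapAt_of_mem _ (hb ▸ hq)) (X q)).symm

lemma contDiffOn_chartField {X : VField m N} {U : Set N}
    (hX : SmoothFieldOn X U) (hU : (extChartAt (𝓡 m) c).source ⊆ U) :
    ContDiffOn ℝ ∞ (chartField c X) (extChartAt (𝓡 m) c).target := by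
  rw [← contMDiffOn_iff_contDiffOn]
  exact (contMDiffOn_field_iff.mp (hX.mono hU)).comp (contMDiffOn_extChartAt_symm c)
    fun z hz ↦ (extChartAt (𝓡 m) c).map_target hz

/-- The vector field, on the domain of the chart around `c`, with the constant coordinates `u`. -/
def coordField (c : N) (u : EuclideanSpace ℝ (Fin m)) : VField m N := fun q ↦ (dchart c q).inverse u

lemma dchart_coordField (hq : q ∈ (extChartAt (𝓡 m) c).source) (u : EuclideanSpace ℝ (Fin m)) :
    dchart c q (coordField c u q) = u := (dchart_isInvertible hq).self_apply_inverse u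

lemma smoothFieldOn_coordField (c : N) (u : EuclideanSpace ℝ (Fin m)) :
    SmoothFieldOn (coordField c u) (extChartAt (𝓡 m) c).source := by
  rw [contMDiffOn_field_iff]
  exact contMDiffOn_const.congr fun q hq ↦ dchart_coordField hq u

lemma coordField_symm (hz : z ∈ (extChartAt (𝓡 m) c).target) (u : EuclideanSpace ℝ (Fin m)) :
    coordField c u ((extChartAt (𝓡 m) c).symm z) = dchartSymm c z u := by
  refine dchart_injective ((extChartAt (𝓡 m) c).map_target hz) ?_
  rw [dchart_coordField ((extChartAt (𝓡 m) c).map_target hz), dchart_dchartSymm hz]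

/-- A field of endomorphisms read in the chart around `c`. -/
def chartEnd (c : N) (S : ∀ x : N, TangentSpace (𝓡 m) x →L[ℝ] TangentSpace (𝓡 m) x)
    (z : EuclideanSpace ℝ (Fin m)) : EuclideanSpace ℝ (Fin m) →L[ℝ] EuclideanSpace ℝ (Fin m) :=
  (dchart c _).comp ((S ((extChartAt (𝓡 m) c).symm z)).comp (dchartSymm c z))

lemma chartEnd_dchart (S : ∀ x : N, TangentSpace (𝓡 m) x →L[ℝ] TangentSpace (𝓡 m) x)
    (hz : z ∈ (extChartAt (𝓡 m) c).target)
    (v : TangentSpace (𝓡 m) ((extChartAt (𝓡 m) c).symm z)) :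
    chartEnd c S z (dchart c _ v) = dchart c _ (S _ v) := by
  change dchart c _ (S _ (dchartSymm c z (dchart c _ v))) = _
  rw [dchartSymm_dchart hz]

lemma SmoothEnd.apply {S : ∀ x : N, TangentSpace (𝓡 m) x →L[ℝ] TangentSpace (𝓡 m) x}
    (hS : SmoothEnd S) {X : VField m N} {U : Set N} (hX : SmoothFieldOn X U) :
    SmoothFieldOn (fun x ↦ S x (X x)) U :=
  ContMDiffOn.clm_bundle_apply (E₁ := fun x : N ↦ TangentSpace (𝓡 m) x)
    (E₂ := fun x : N ↦ TangentSpace (𝓡 m) x) (b := fun x ↦ x) hS.contMDiffOn hX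

lemma SmoothField.smoothFieldOn {X : VField m N} (hX : SmoothField X) (U : Set N) :
    SmoothFieldOn X U := ContMDiff.contMDiffOn hX

lemma smoothField_iff {X : VField m N} : SmoothField X ↔ SmoothFieldOn X univ :=
  contMDiffOn_univ.symm

/-- In finite dimension it suffices to evaluate on constant vectors, that is, to apply `S` to
coordinate fields. -/
lemma contDiffOn_chartEnd {S : ∀ x : N, TangentSpace (𝓡 m) x →L[ℝ] TangentSpace (𝓡 m) x}
    (hS : SmoothEnd S) : ContDiffOn ℝ ∞ (chartEnd c S) (extChartAt (𝓡 m) c).target := by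
  rw [contDiffOn_clm_apply]
  intro u
  refine (contDiffOn_chartField (hS.apply (smoothFieldOn_coordField c u)) subset_rfl).congr
    fun z hz ↦ ?_
  rw [chartField, coordField_symm hz]
  rfl

lemma contMDiffOn_symm_comp {f : N → ℝ} (hf : ContMDiff (𝓡 m) 𝓘(ℝ, ℝ) ∞ f) (c : N) :
    ContDiffOn ℝ ∞ (f ∘ (extChartAt (𝓡 m) c).symm) (extChartAt (𝓡 m) c).target := by
  rw [← contMDiffOn_iff_contDiffOn]
  exact hf.comp_contMDiffOn (contMDiffOn_extChartAt_symm c)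

namespace LorentzMetric

variable (G : LorentzMetric m N)

lemma contDiffOn_inChart (c : N) :
    ContDiffOn ℝ ∞ (G.inChart c) (extChartAt (𝓡 m) c).target := by
  rw [contDiffOn_clm_apply]
  intro u
  rw [contDiffOn_clm_apply]
  intro w
  have h : ContMDiffOn (𝓡 m) ((𝓡 m).prod 𝓘(ℝ, ℝ)) ∞
      (fun x ↦ TotalSpace.mk' ℝ (E := Bundle.Trivial N ℝ) x
        (G.inner x (coordField c u x) (coordField c w x)))
      (extChartAt (𝓡 m) c).source :=
    ContMDiffOn.clm_bundle_apply₂ (E₁ := fun x : N ↦ TangentSpace (𝓡 m) x)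
      (E₂ := fun x : N ↦ TangentSpace (𝓡 m) x) (E₃ := Bundle.Trivial N ℝ) (b := fun x ↦ x)
      G.contMDiff.contMDiffOn (smoothFieldOn_coordField c u) (smoothFieldOn_coordField c w)
  have h2 : ContMDiffOn (𝓡 m) 𝓘(ℝ, ℝ) ∞
      (fun x ↦ G.inner x (coordField c u x) (coordField c w x)) (extChartAt (𝓡 m) c).source :=
    fun x hx ↦ (contMDiffWithinAt_totalSpace.mp (h x hx)).2
  rw [← contMDiffOn_iff_contDiffOn]
  refine (h2.comp (contMDiffOn_extChartAt_symm c)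
    fun z hz ↦ (extChartAt (𝓡 m) c).map_target hz).congr fun z hz ↦ ?_
  simp only [Function.comp_apply]
  rw [coordField_symm hz, coordField_symm hz]
  rfl

lemma inChart_dchart (hq : q ∈ (extChartAt (𝓡 m) c).source) (v w : TangentSpace (𝓡 m) q) :
    G.inChart c (extChartAt (𝓡 m) c q) (dchart c q v) (dchart c q w) = G.inner q v w := by
  obtain ⟨z, hz, rfl⟩ : ∃ z ∈ (extChartAt (𝓡 m) c).target, (extChartAt (𝓡 m) c).symm z = q :=
    ⟨_, (extChartAt (𝓡 m) c).map_source hq, (extChartAt (𝓡 m) c).left_inv hq⟩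
  rw [(extChartAt (𝓡 m) c).right_inv hz]
  change G.inner _ (dchartSymm c z _) (dchartSymm c z _) = _
  rw [dchartSymm_dchart hz, dchartSymm_dchart hz]

lemma inChart_symm (c : N) (x u w : EuclideanSpace ℝ (Fin m)) :
    G.inChart c x u w = G.inChart c x w u := G.symm _ _ _

lemma contDiffAt_inChart {x : EuclideanSpace ℝ (Fin m)} (hx : x ∈ (extChartAt (𝓡 m) c).target) :
    ContDiffAt ℝ ∞ (G.inChart c) x :=
  (G.contDiffOn_inChart c).contDiffAt ((isOpen_extChartAt_target c).mem_nhds hx)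

lemma fderiv_inChart_symm {x : EuclideanSpace ℝ (Fin m)} (hx : x ∈ (extChartAt (𝓡 m) c).target)
    (a u w : EuclideanSpace ℝ (Fin m)) :
    fderiv ℝ (G.inChart c) x a u w = fderiv ℝ (G.inChart c) x a w u :=
  fderiv_bilin_symm ((G.contDiffAt_inChart hx).differentiableAt (by simp)) (G.inChart_symm c) a u w

lemma christoffel_eq (c : N) (x u w : EuclideanSpace ℝ (Fin m)) :
    G.christoffel c x u w = koszul (fderiv ℝ (G.inChart c) x) u w := rfl

end LorentzMetric

end Charts

/-! ### The Levi-Civita connection along a map -/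

lemma hasFDerivAt_comp_clm_apply {U V W : Type*} [NormedAddCommGroup U] [NormedSpace ℝ U]
    [NormedAddCommGroup V] [NormedSpace ℝ V] [NormedAddCommGroup W] [NormedSpace ℝ W]
    {B : V → V →L[ℝ] W} {F v : U → V} {x : U}
    (hB : DifferentiableAt ℝ B (F x)) (hF : DifferentiableAt ℝ F x)
    (hv : DifferentiableAt ℝ v x) :
    HasFDerivAt (fun z ↦ B (F z) (v z)) ((B (F x)).comp (fderiv ℝ v x) +
      ((fderiv ℝ B (F x)).comp (fderiv ℝ F x)).flip (v x)) x :=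
  (hB.hasFDerivAt.comp x hF.hasFDerivAt).clm_apply hv.hasFDerivAt

lemma hasFDerivAt_bilin {U V : Type*} [NormedAddCommGroup U] [NormedSpace ℝ U]
    [NormedAddCommGroup V] [NormedSpace ℝ V] {B : V → V →L[ℝ] V →L[ℝ] ℝ} {F v w : U → V} {x : U}
    (hB : DifferentiableAt ℝ B (F x)) (hF : DifferentiableAt ℝ F x)
    (hv : DifferentiableAt ℝ v x) (hw : DifferentiableAt ℝ w x) :
    DifferentiableAt ℝ (fun z ↦ B (F z) (v z) (w z)) x ∧ ∀ a,
      fderiv ℝ (fun z ↦ B (F z) (v z) (w z)) x a =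
        fderiv ℝ B (F x) (fderiv ℝ F x a) (v x) (w x) + B (F x) (fderiv ℝ v x a) (w x) +
          B (F x) (v x) (fderiv ℝ w x a) := by
  have h2 := hasFDerivAt_comp_clm_apply hB hF hv
  have h3 := h2.clm_apply hw.hasFDerivAt
  refine ⟨h3.differentiableAt, fun a ↦ (congrArg (fun L ↦ L a) h3.fderiv).trans ?_⟩
  change B (F x) (v x) (fderiv ℝ w x a) + (B (F x) (fderiv ℝ v x a) (w x) +
    fderiv ℝ B (F x) (fderiv ℝ F x a) (v x) (w x)) = _
  ring

section Along

variable {k m : ℕ} {M N : Type*} [TopologicalSpace M]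
  [ChartedSpace (EuclideanSpace ℝ (Fin k)) M] [IsManifold (𝓡 k) ∞ M] [TopologicalSpace N]
  [ChartedSpace (EuclideanSpace ℝ (Fin m)) N] [IsManifold (𝓡 m) ∞ N]

/-- Derivatives of vector valued functions are computed in charts. -/
lemma hasMFDerivAt_of_eventuallyEq_chart {W : Type*} [NormedAddCommGroup W] [NormedSpace ℝ W]
    {c q : M} (hq : q ∈ (extChartAt (𝓡 k) c).source) {h : M → W}
    {g : EuclideanSpace ℝ (Fin k) → W} (hg : DifferentiableAt ℝ g (extChartAt (𝓡 k) c q))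
    (he : h =ᶠ[𝓝 q] fun y ↦ g (extChartAt (𝓡 k) c y)) :
    HasMFDerivAt (𝓡 k) 𝓘(ℝ, W) h q ((fderiv ℝ g (extChartAt (𝓡 k) c q)).comp (dchart c q)) := by
  have h1 : MDifferentiableAt (𝓡 k) 𝓘(ℝ, EuclideanSpace ℝ (Fin k)) (extChartAt (𝓡 k) c) q :=
    mdifferentiableAt_extChartAt (by rwa [extChartAt_source] at hq)
  exact (HasMFDerivAt.comp q hg.hasFDerivAt.hasMFDerivAt h1.hasMFDerivAt).congr_of_eventuallyEq he

/-- The differential of a vector valued function, with values in the vector space. -/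
def vdiff {W : Type*} [NormedAddCommGroup W] [NormedSpace ℝ W] (h : M → W) (p : M) :
    TangentSpace (𝓡 k) p →L[ℝ] W := mfderiv (𝓡 k) 𝓘(ℝ, W) h p

lemma vdiff_eq_of_eventuallyEq_chart {W : Type*} [NormedAddCommGroup W] [NormedSpace ℝ W]
    {c q : M} (hq : q ∈ (extChartAt (𝓡 k) c).source) {h : M → W}
    {g : EuclideanSpace ℝ (Fin k) → W} (hg : DifferentiableAt ℝ g (extChartAt (𝓡 k) c q))
    (he : h =ᶠ[𝓝 q] fun y ↦ g (extChartAt (𝓡 k) c y)) (v : TangentSpace (𝓡 k) q) :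
    vdiff h q v = fderiv ℝ g (extChartAt (𝓡 k) c q) (dchart c q v) :=
  congrArg (fun L ↦ L v) (hasMFDerivAt_of_eventuallyEq_chart hq hg he).mfderiv

lemma vdiff_add {W : Type*} [NormedAddCommGroup W] [NormedSpace ℝ W] {g h : M → W} {p : M}
    (hg : MDifferentiableAt (𝓡 k) 𝓘(ℝ, W) g p) (hh : MDifferentiableAt (𝓡 k) 𝓘(ℝ, W) h p)
    (v : TangentSpace (𝓡 k) p) :
    vdiff (fun q ↦ g q + h q) p v = vdiff g p v + vdiff h p v :=
  congrArg (fun L ↦ L v) (hg.hasMFDerivAt.add hh.hasMFDerivAt).mfderiv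

lemma eventuallyEq_chart {W : Type*} {c q : M} (hq : q ∈ (extChartAt (𝓡 k) c).source)
    (h : M → W) :
    h =ᶠ[𝓝 q] fun y ↦ (h ∘ (extChartAt (𝓡 k) c).symm) (extChartAt (𝓡 k) c y) := by
  filter_upwards [(isOpen_extChartAt_source (I := 𝓡 k) c).mem_nhds hq] with y hy
  simp only [Function.comp_apply]
  rw [(extChartAt (𝓡 k) c).left_inv hy]

lemma differentiableAt_comp_symm {W : Type*} [NormedAddCommGroup W] [NormedSpace ℝ W]
    {c q : M} (hq : q ∈ (extChartAt (𝓡 k) c).source) {h : M → W}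
    (hh : MDifferentiableAt (𝓡 k) 𝓘(ℝ, W) h q) :
    DifferentiableAt ℝ (h ∘ (extChartAt (𝓡 k) c).symm) (extChartAt (𝓡 k) c q) := by
  rw [← mdifferentiableAt_iff_differentiableAt]
  have h1 : MDifferentiableAt 𝓘(ℝ, EuclideanSpace ℝ (Fin k)) (𝓡 k) (extChartAt (𝓡 k) c).symm
      (extChartAt (𝓡 k) c q) := by
    have := mdifferentiableWithinAt_extChartAt_symm (I := 𝓡 k)
      ((extChartAt (𝓡 k) c).map_source hq)
    rwa [modelWithCornersSelf_coe, range_id, mdifferentiableWithinAt_univ] at this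
  refine MDifferentiableAt.comp _ ?_ h1
  rwa [(extChartAt (𝓡 k) c).left_inv hq]

lemma vdiff_smul {W : Type*} [NormedAddCommGroup W] [NormedSpace ℝ W] {r : M → ℝ} {h : M → W}
    {p : M} (hr : MDifferentiableAt (𝓡 k) 𝓘(ℝ, ℝ) r p)
    (hh : MDifferentiableAt (𝓡 k) 𝓘(ℝ, W) h p) (v : TangentSpace (𝓡 k) p) :
    vdiff (fun q ↦ r q • h q) p v = vdiff r p v • h p + r p • vdiff h p v := by
  have hp := mem_extChartAt_source (I := 𝓡 k) p
  have h1 := differentiableAt_comp_symm hp hr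
  have h2 := differentiableAt_comp_symm hp hh
  have e : (extChartAt (𝓡 k) p).symm (extChartAt (𝓡 k) p p) = p :=
    (extChartAt (𝓡 k) p).left_inv hp
  rw [vdiff_eq_of_eventuallyEq_chart hp h1 (eventuallyEq_chart hp _),
    vdiff_eq_of_eventuallyEq_chart hp h2 (eventuallyEq_chart hp _),
    vdiff_eq_of_eventuallyEq_chart hp (h1.smul h2) (by
      filter_upwards [eventuallyEq_chart hp r, eventuallyEq_chart hp h] with q h h'
      rw [h, h']; rfl), fderiv_smul h1 h2]
  simp only [Function.comp_apply, add_apply, smul_apply, ContinuousLinearMap.smulRight_apply, e]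
  exact add_comm _ _

section LocalRep

variable {f : M → N} (hf : ContMDiff (𝓡 k) (𝓡 m) ∞ f)

/-- The map `f` read in the charts around `c` and `d`. -/
def localRep (f : M → N) (c : M) (d : N) : EuclideanSpace ℝ (Fin k) → EuclideanSpace ℝ (Fin m) :=
  extChartAt (𝓡 m) d ∘ f ∘ (extChartAt (𝓡 k) c).symm

lemma contDiffAt_localRep {f : M → N} {c q : M} {d : N}
    (hf : ∀ᶠ y in 𝓝 q, ContMDiffAt (𝓡 k) (𝓡 m) ∞ f y)
    (hq : q ∈ (extChartAt (𝓡 k) c).source) (hd : f q ∈ (extChartAt (𝓡 m) d).source) :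
    ContDiffAt ℝ ∞ (localRep (k := k) (m := m) f c d) (extChartAt (𝓡 k) c q) := by
  rw [← contMDiffAt_iff_contDiffAt]
  have h1 : ContMDiffAt 𝓘(ℝ, EuclideanSpace ℝ (Fin k)) (𝓡 k) ∞ (extChartAt (𝓡 k) c).symm
      (extChartAt (𝓡 k) c q) :=
    (contMDiffOn_extChartAt_symm c).contMDiffAt
      ((isOpen_extChartAt_target c).mem_nhds ((extChartAt (𝓡 k) c).map_source hq))
  have e := (extChartAt (𝓡 k) c).left_inv hq
  refine ContMDiffAt.comp (I' := 𝓡 m) _ ?_ (ContMDiffAt.comp (I' := 𝓡 k) _ ?_ h1)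
  · simp only [Function.comp_apply]
    rw [e]
    exact contMDiffAt_extChartAt' (by rwa [extChartAt_source] at hd)
  · rw [e]
    exact hf.self_of_nhds

lemma dchart_mfderiv {f : M → N} {c q : M} {d : N}
    (hf : ∀ᶠ y in 𝓝 q, ContMDiffAt (𝓡 k) (𝓡 m) ∞ f y)
    (hq : q ∈ (extChartAt (𝓡 k) c).source) (hd : f q ∈ (extChartAt (𝓡 m) d).source)
    (v : TangentSpace (𝓡 k) q) :
    dchart d (f q) (mfderiv (𝓡 k) (𝓡 m) f q v) =
      fderiv ℝ (localRep (k := k) (m := m) f c d) (extChartAt (𝓡 k) c q) (dchart c q v) := by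
  have h1 : MDifferentiableAt (𝓡 m) 𝓘(ℝ, EuclideanSpace ℝ (Fin m)) (extChartAt (𝓡 m) d) (f q) :=
    mdifferentiableAt_extChartAt (by rwa [extChartAt_source] at hd)
  have h2 : MDifferentiableAt (𝓡 k) (𝓡 m) f q := hf.self_of_nhds.mdifferentiableAt (by simp)
  have h3 := vdiff_eq_of_eventuallyEq_chart hq (h := extChartAt (𝓡 m) d ∘ f)
    (g := localRep (k := k) (m := m) f c d)
    ((contDiffAt_localRep hf hq hd).differentiableAt (by simp)) (eventuallyEq_chart hq _) v
  rw [vdiff, mfderiv_comp q h1 h2] at h3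
  exact h3

/-- The field `df(Y)` along `f`, read in charts. -/
lemma eventuallyEq_dchart_mfderiv {f : M → N} (hf : ContMDiff (𝓡 k) (𝓡 m) ∞ f) {c p : M} {d : N}
    (hp : p ∈ (extChartAt (𝓡 k) c).source) (hd : f p ∈ (extChartAt (𝓡 m) d).source)
    (Y : VField k M) :
    (fun q ↦ dchart d (f q) (mfderiv (𝓡 k) (𝓡 m) f q (Y q))) =ᶠ[𝓝 p] fun q ↦
      (fun z ↦ fderiv ℝ (localRep (k := k) (m := m) f c d) z (chartField c Y z))
        (extChartAt (𝓡 k) c q) := by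
  filter_upwards [(isOpen_extChartAt_source (I := 𝓡 k) c).mem_nhds hp,
    hf.continuous.continuousAt.preimage_mem_nhds
      ((isOpen_extChartAt_source (I := 𝓡 m) d).mem_nhds hd)] with q hq hfq
  rw [dchart_mfderiv (.of_forall hf) hq hfq]
  rw [chartField, (extChartAt (𝓡 k) c).left_inv hq]

lemma SmoothField.differentiableAt_chartField {Y : VField k M} (hY : SmoothField Y) {c p : M}
    (hp : p ∈ (extChartAt (𝓡 k) c).source) :
    DifferentiableAt ℝ (chartField c Y) (extChartAt (𝓡 k) c p) :=
  ((contDiffOn_chartField (hY.smoothFieldOn univ) (subset_univ _)).contDiffAt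
    ((isOpen_extChartAt_target c).mem_nhds ((extChartAt (𝓡 k) c).map_source hp))).differentiableAt
    (by simp)

lemma hasFDerivAt_fderiv_localRep {f : M → N} (hf : ContMDiff (𝓡 k) (𝓡 m) ∞ f) {c p : M} {d : N}
    (hp : p ∈ (extChartAt (𝓡 k) c).source) (hd : f p ∈ (extChartAt (𝓡 m) d).source)
    {Y : VField k M} (hY : SmoothField Y) :
    HasFDerivAt (fun z ↦ fderiv ℝ (localRep (k := k) (m := m) f c d) z (chartField c Y z))
      ((fderiv ℝ (localRep (k := k) (m := m) f c d) (extChartAt (𝓡 k) c p)).comp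
        (fderiv ℝ (chartField c Y) (extChartAt (𝓡 k) c p)) +
        (fderiv ℝ (fderiv ℝ (localRep (k := k) (m := m) f c d)) (extChartAt (𝓡 k) c p)).flip
          (chartField c Y (extChartAt (𝓡 k) c p))) (extChartAt (𝓡 k) c p) := by
  have h1 := ((contDiffAt_infty.mp (contDiffAt_localRep (k := k) (m := m) (.of_forall hf) hp hd)
    2).fderiv_right (m := 1) (by norm_num)).differentiableAt (by simp)
  exact h1.hasFDerivAt.clm_apply (hY.differentiableAt_chartField hp).hasFDerivAt

end LocalRep

namespace LorentzMetric

variable (G : LorentzMetric m N)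

/-- The Christoffel symbols of the second kind at the centre of the chart. -/
def christoffelSharp (q : N) (u w : EuclideanSpace ℝ (Fin m)) : TangentSpace (𝓡 m) q :=
  ((G.form q).toDual (G.nondegenerate q)).symm
    (((G.christoffel q (extChartAt (𝓡 m) q q) u w).comp (dchart q q)).toLinearMap)

lemma inner_christoffelSharp (q : N) (u w : EuclideanSpace ℝ (Fin m)) (y : TangentSpace (𝓡 m) q) :
    G.inner q (G.christoffelSharp q u w) y =
      G.christoffel q (extChartAt (𝓡 m) q q) u w (dchart q q y) :=
  LinearMap.BilinForm.apply_toDual_symm_apply (B := G.form q) (hB := G.nondegenerate q) _ y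

lemma eq_of_inner_eq {q : N} {a b : TangentSpace (𝓡 m) q}
    (h : ∀ y, G.inner q a y = G.inner q b y) : a = b :=
  sub_eq_zero.mp ((G.nondegenerate q).1 _ fun y ↦ by
    rw [form_apply, map_sub, sub_apply, h, sub_self])

lemma christoffelSharp_symm (q : N) (u w : EuclideanSpace ℝ (Fin m)) :
    G.christoffelSharp q u w = G.christoffelSharp q w u := by
  refine G.eq_of_inner_eq fun y ↦ ?_
  rw [inner_christoffelSharp, inner_christoffelSharp, christoffel_eq, christoffel_eq,
    koszul_symm (G.fderiv_inChart_symm (mem_extChartAt_target q))]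

lemma christoffelSharp_add_right (q : N) (u w w' : EuclideanSpace ℝ (Fin m)) :
    G.christoffelSharp q u (w + w') = G.christoffelSharp q u w + G.christoffelSharp q u w' := by
  refine G.eq_of_inner_eq fun y ↦ ?_
  rw [map_add, add_apply]
  simp only [inner_christoffelSharp, christoffel_eq, koszul_add_right]
  rfl

lemma christoffelSharp_smul_right (q : N) (r : ℝ) (u w : EuclideanSpace ℝ (Fin m)) :
    G.christoffelSharp q u (r • w) = r • G.christoffelSharp q u w := by
  refine G.eq_of_inner_eq fun y ↦ ?_
  rw [map_smul, smul_apply]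
  simp only [inner_christoffelSharp, christoffel_eq, koszul_smul_right]
  rfl

lemma christoffelSharp_add_left (q : N) (u u' w : EuclideanSpace ℝ (Fin m)) :
    G.christoffelSharp q (u + u') w = G.christoffelSharp q u w + G.christoffelSharp q u' w := by
  rw [christoffelSharp_symm, christoffelSharp_add_right, christoffelSharp_symm _ _ w u,
    christoffelSharp_symm _ _ w u']

variable {f : M → N} {V W : ∀ q : M, TangentSpace (𝓡 m) (f q)} {p : M}

/-- Differentiability at `p` of a vector field along `f`. -/
def DiffAlong (f : M → N) (V : ∀ q : M, TangentSpace (𝓡 m) (f q)) (p : M) : Prop :=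
  MDifferentiableAt (𝓡 k) 𝓘(ℝ, EuclideanSpace ℝ (Fin m)) (fun q ↦ dchart (f p) (f q) (V q)) p

lemma covAlong_eq (f : M → N) (V : ∀ q : M, TangentSpace (𝓡 m) (f q)) (p : M)
    (v : TangentSpace (𝓡 k) p) :
    G.covAlong f V p v = (dchart (f p) (f p)).inverse
        (vdiff (fun q ↦ dchart (f p) (f q) (V q)) p v) +
      G.christoffelSharp (f p) (dchart (f p) (f p) (mfderiv (𝓡 k) (𝓡 m) f p v))
        (dchart (f p) (f p) (V p)) := rfl

lemma covAlong_add_left (f : M → N) (V : ∀ q : M, TangentSpace (𝓡 m) (f q)) (p : M)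
    (v w : TangentSpace (𝓡 k) p) :
    G.covAlong f V p (v + w) = G.covAlong f V p v + G.covAlong f V p w := by
  simp only [covAlong_eq]
  rw [map_add, map_add, map_add, map_add, christoffelSharp_add_left]
  abel

lemma covAlong_add_right (hV : DiffAlong (k := k) f V p) (hW : DiffAlong (k := k) f W p)
    (v : TangentSpace (𝓡 k) p) :
    G.covAlong f (fun q ↦ V q + W q) p v = G.covAlong f V p v + G.covAlong f W p v := by
  simp only [covAlong_eq, map_add]
  rw [vdiff_add hV hW, map_add, christoffelSharp_add_right]
  abel

lemma covAlong_smul_right {r : M → ℝ} (hr : MDifferentiableAt (𝓡 k) 𝓘(ℝ, ℝ) r p)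
    (hV : DiffAlong (k := k) f V p) (v : TangentSpace (𝓡 k) p) :
    G.covAlong f (fun q ↦ r q • V q) p v = vdiff r p v • V p + r p • G.covAlong f V p v := by
  simp only [covAlong_eq, map_smul]
  rw [vdiff_smul hr hV, map_add, map_smul, map_smul, christoffelSharp_smul_right,
    (dchart_isInvertible (mem_extChartAt_source (I := 𝓡 m) (f p))).inverse_apply_self]
  module

/-- Pairing with `w` removes both inverses from the formula for `covAlong`: the chart carries the
metric to `inChart`, and the second term was defined by duality. -/
lemma inner_covAlong (v : TangentSpace (𝓡 k) p) (w : TangentSpace (𝓡 m) (f p)) :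
    G.inner (f p) (G.covAlong f V p v) w =
      G.inChart (f p) (extChartAt (𝓡 m) (f p) (f p))
        (vdiff (fun q ↦ dchart (f p) (f q) (V q)) p v) (dchart (f p) (f p) w) +
      G.christoffel (f p) (extChartAt (𝓡 m) (f p) (f p))
        (dchart (f p) (f p) (mfderiv (𝓡 k) (𝓡 m) f p v)) (dchart (f p) (f p) (V p))
        (dchart (f p) (f p) w) := by
  have hs := mem_extChartAt_source (I := 𝓡 m) (f p)
  rw [covAlong_eq, map_add, add_apply, inner_christoffelSharp, ← G.inChart_dchart hs,
    (dchart_isInvertible hs).self_apply_inverse]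

/-- The connection along a map is compatible with the metric. -/
lemma vdiff_inner (hf : ContMDiff (𝓡 k) (𝓡 m) ∞ f) (hV : DiffAlong (k := k) f V p)
    (hW : DiffAlong (k := k) f W p) (v : TangentSpace (𝓡 k) p) :
    vdiff (fun q ↦ G.inner (f q) (V q) (W q)) p v =
      G.inner (f p) (G.covAlong f V p v) (W p) + G.inner (f p) (V p) (G.covAlong f W p v) := by
  have hp := mem_extChartAt_source (I := 𝓡 k) p
  have hs := mem_extChartAt_source (I := 𝓡 m) (f p)
  have e : (extChartAt (𝓡 k) p).symm (extChartAt (𝓡 k) p p) = p :=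
    (extChartAt (𝓡 k) p).left_inv hp
  have h1 := differentiableAt_comp_symm hp hV
  have h2 := differentiableAt_comp_symm hp hW
  have h3 : DifferentiableAt ℝ (localRep (k := k) (m := m) f p (f p)) (extChartAt (𝓡 k) p p) :=
    (contDiffAt_localRep (.of_forall hf) hp hs).differentiableAt (by simp)
  have hF : localRep (k := k) (m := m) f p (f p) (extChartAt (𝓡 k) p p) =
      extChartAt (𝓡 m) (f p) (f p) := by
    rw [localRep, Function.comp_apply, Function.comp_apply, e]
  have h4 : DifferentiableAt ℝ (G.inChart (f p))
      (localRep (k := k) (m := m) f p (f p) (extChartAt (𝓡 k) p p)) := by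
    rw [hF]
    exact (G.contDiffAt_inChart (mem_extChartAt_target (f p))).differentiableAt (by simp)
  obtain ⟨h5, h5'⟩ := hasFDerivAt_bilin h4 h3 h1 h2
  have he : (fun q ↦ G.inner (f q) (V q) (W q)) =ᶠ[𝓝 p] fun q ↦ (fun z ↦
      G.inChart (f p) (localRep (k := k) (m := m) f p (f p) z)
        (((fun q ↦ dchart (f p) (f q) (V q)) ∘ (extChartAt (𝓡 k) p).symm) z)
        (((fun q ↦ dchart (f p) (f q) (W q)) ∘ (extChartAt (𝓡 k) p).symm) z))
      (extChartAt (𝓡 k) p q) := by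
    filter_upwards [(isOpen_extChartAt_source (I := 𝓡 k) p).mem_nhds hp,
      hf.continuous.continuousAt.preimage_mem_nhds
        ((isOpen_extChartAt_source (I := 𝓡 m) (f p)).mem_nhds hs)] with q hq hfq
    simp only [Function.comp_apply, localRep]
    rw [(extChartAt (𝓡 k) p).left_inv hq, G.inChart_dchart hfq]
  have hsymm := G.symm (f p) (V p) (G.covAlong f W p v)
  rw [vdiff_eq_of_eventuallyEq_chart hp h5 he, h5', hsymm,
    inner_covAlong, inner_covAlong,
    vdiff_eq_of_eventuallyEq_chart hp h1 (eventuallyEq_chart hp _),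
    vdiff_eq_of_eventuallyEq_chart hp h2 (eventuallyEq_chart hp _),
    dchart_mfderiv (.of_forall hf) hp hs]
  rw [hF, Function.comp_apply, Function.comp_apply, e]
  -- The two Christoffel terms add up to the derivative of the metric coefficients.
  have h6 := koszul_add_koszul (G.fderiv_inChart_symm (mem_extChartAt_target (I := 𝓡 m) (f p)))
    (fderiv ℝ (localRep (k := k) (m := m) f p (f p)) (extChartAt (𝓡 k) p p) (dchart p p v))
    (dchart (f p) (f p) (V p)) (dchart (f p) (f p) (W p))
  rw [christoffel_eq, christoffel_eq, ← h6, G.inChart_symm (f p) _ (dchart (f p) (f p) (V p))]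
  ring

lemma diffAlong_mfderiv (hf : ContMDiff (𝓡 k) (𝓡 m) ∞ f) {Y : VField k M} (hY : SmoothField Y)
    (p : M) : DiffAlong (k := k) f (fun q ↦ mfderiv (𝓡 k) (𝓡 m) f q (Y q)) p :=
  (hasMFDerivAt_of_eventuallyEq_chart (mem_extChartAt_source p)
    (hasFDerivAt_fderiv_localRep hf (mem_extChartAt_source p) (mem_extChartAt_source (f p))
      hY).differentiableAt
    (eventuallyEq_dchart_mfderiv hf (mem_extChartAt_source p) (mem_extChartAt_source (f p))
      Y)).mdifferentiableAt

/-- The Lie bracket of two vector fields read in the chart around `c`. -/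
def chartBracket (c : M) (X Y : VField k M) (z : EuclideanSpace ℝ (Fin k)) :
    EuclideanSpace ℝ (Fin k) :=
  fderiv ℝ (chartField c Y) z (chartField c X z) - fderiv ℝ (chartField c X) z (chartField c Y z)

/-- The connection along a map is torsion free. -/
lemma covAlong_sub_covAlong (hf : ContMDiff (𝓡 k) (𝓡 m) ∞ f) {X Y : VField k M}
    (hX : SmoothField X) (hY : SmoothField Y) {c : M} (hp : p ∈ (extChartAt (𝓡 k) c).source)
    {w : TangentSpace (𝓡 k) p} (hw : dchart c p w = chartBracket c X Y (extChartAt (𝓡 k) c p)) :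
    G.covAlong f (fun q ↦ mfderiv (𝓡 k) (𝓡 m) f q (Y q)) p (X p) -
      G.covAlong f (fun q ↦ mfderiv (𝓡 k) (𝓡 m) f q (X q)) p (Y p) =
      mfderiv (𝓡 k) (𝓡 m) f p w := by
  have hs := mem_extChartAt_source (I := 𝓡 m) (f p)
  have hX' := hasFDerivAt_fderiv_localRep hf hp hs hX
  have hY' := hasFDerivAt_fderiv_localRep hf hp hs hY
  have hsymm : IsSymmSndFDerivAt ℝ (localRep (k := k) (m := m) f c (f p))
      (extChartAt (𝓡 k) c p) :=
    (contDiffAt_infty.mp (contDiffAt_localRep (k := k) (m := m) (.of_forall hf) hp hs)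
      2).isSymmSndFDerivAt (by simp)
  have eX : ∀ X : VField k M, chartField c X (extChartAt (𝓡 k) c p) = dchart c p (X p) := by
    intro X
    rw [chartField, (extChartAt (𝓡 k) c).left_inv hp]
  -- The Christoffel terms cancel by symmetry. The second derivatives of the local representative of
  -- `f` cancel too, leaving the bracket.
  rw [covAlong_eq, covAlong_eq, christoffelSharp_symm, add_sub_add_right_eq_sub, ← map_sub]
  refine dchart_injective hs ?_
  rw [(dchart_isInvertible hs).self_apply_inverse, dchart_mfderiv (.of_forall hf) hp hs, hw,
    vdiff_eq_of_eventuallyEq_chart hp hX'.differentiableAt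
      (eventuallyEq_dchart_mfderiv hf hp hs X),
    vdiff_eq_of_eventuallyEq_chart hp hY'.differentiableAt
      (eventuallyEq_dchart_mfderiv hf hp hs Y), hX'.fderiv, hY'.fderiv, chartBracket]
  simp only [add_apply, ContinuousLinearMap.comp_apply, ContinuousLinearMap.flip_apply, map_sub,
    ← eX]
  rw [hsymm.eq]
  abel

end LorentzMetric

end Along

/-! ### Global smooth vector fields -/

section Fields

variable {m : ℕ} {N : Type*} [TopologicalSpace N]
  [ChartedSpace (EuclideanSpace ℝ (Fin m)) N] [IsManifold (𝓡 m) ∞ N]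

lemma SmoothField.add {X Y : VField m N} (hX : SmoothField X) (hY : SmoothField Y) :
    SmoothField (fun q ↦ X q + Y q) :=
  ContMDiff.add_section (V := fun x : N ↦ TangentSpace (𝓡 m) x) hX hY

lemma SmoothField.sub {X Y : VField m N} (hX : SmoothField X) (hY : SmoothField Y) :
    SmoothField (fun q ↦ X q - Y q) :=
  ContMDiff.sub_section (V := fun x : N ↦ TangentSpace (𝓡 m) x) hX hY

lemma SmoothField.smul {r : N → ℝ} (hr : ContMDiff (𝓡 m) 𝓘(ℝ, ℝ) ∞ r) {X : VField m N}
    (hX : SmoothField X) : SmoothField (fun q ↦ r q • X q) :=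
  ContMDiff.smul_section (V := fun x : N ↦ TangentSpace (𝓡 m) x) hr hX

lemma SmoothEnd.smoothField {S : ∀ x : N, TangentSpace (𝓡 m) x →L[ℝ] TangentSpace (𝓡 m) x}
    (hS : SmoothEnd S) {X : VField m N} (hX : SmoothField X) :
    SmoothField (fun x ↦ S x (X x)) :=
  smoothField_iff.mpr (hS.apply (hX.smoothFieldOn univ))

/-- Every tangent vector extends to a global smooth vector field. -/
lemma exists_smoothField_eq [T2Space N] (p : N) (v : TangentSpace (𝓡 m) p) :
    ∃ X : VField m N, SmoothField X ∧ X p = v := by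
  obtain ⟨s, hs, hX⟩ := FiberBundle.exists_contMDiffOn_extend (k := ∞) (𝓡 m)
    (EuclideanSpace ℝ (Fin m)) (V := fun x : N ↦ TangentSpace (𝓡 m) x) v
  obtain ⟨u, hus, huo, hpu⟩ := mem_nhds_iff.mp hs
  obtain ⟨f, -, hf⟩ := (SmoothBumpFunction.nhds_basis_tsupport (I := 𝓡 m) p).mem_iff.mp
    (huo.mem_nhds hpu)
  refine ⟨fun q ↦ f q • FiberBundle.extend (EuclideanSpace ℝ (Fin m)) v q, ?_, ?_⟩
  · exact ContMDiffOn.smul_section_of_tsupport (V := fun x : N ↦ TangentSpace (𝓡 m) x)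
      f.contMDiff.contMDiffOn huo hf (hX.mono hus)
  · simp

lemma SmoothField.eigenProd {k : ℕ}
    {S : ∀ x : N, TangentSpace (𝓡 m) x →L[ℝ] TangentSpace (𝓡 m) x} (hS : SmoothEnd S)
    {lam : Fin (k + 1) → N → ℝ} (hlam : ∀ a, ContMDiff (𝓡 m) 𝓘(ℝ, ℝ) ∞ (lam a))
    (hinj : ∀ p, Function.Injective fun a ↦ lam a p) {i : Fin (k + 1)} {X : VField m N}
    (hX : SmoothField X) {L : List (Fin (k + 1))} (hL : ∀ j ∈ L, j ≠ i) :
    SmoothField fun p ↦ _root_.eigenProd (S p) (fun j ↦ lam j p) i L (X p) := by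
  induction L with
  | nil => exact hX
  | cons j L ih =>
    have h := ih fun a ha ↦ hL a (List.mem_cons_of_mem _ ha)
    have hinv : ContMDiff (𝓡 m) 𝓘(ℝ, ℝ) ∞ fun p ↦ (lam i p - lam j p)⁻¹ :=
      ((hlam i).sub (hlam j)).inv₀ fun p ↦
        sub_ne_zero.mpr ((hinj p).ne (hL j List.mem_cons_self).symm)
    exact SmoothField.smul hinv ((hS.smoothField h).sub (SmoothField.smul (hlam j) h))

lemma SmoothField.eigenProj {k : ℕ}
    {S : ∀ x : N, TangentSpace (𝓡 m) x →L[ℝ] TangentSpace (𝓡 m) x} (hS : SmoothEnd S)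
    {lam : Fin (k + 1) → N → ℝ} (hlam : ∀ a, ContMDiff (𝓡 m) 𝓘(ℝ, ℝ) ∞ (lam a))
    (hinj : ∀ p, Function.Injective fun a ↦ lam a p) (i : Fin (k + 1)) {X : VField m N}
    (hX : SmoothField X) :
    SmoothField fun p ↦ _root_.eigenProj (S p) (fun j ↦ lam j p) i (X p) :=
  SmoothField.eigenProd hS hlam hinj hX fun j hj ↦ by simpa using (List.mem_filter.mp hj).2

end Fields

/-! ### The induced connection -/

namespace Hypersurface

variable {n : ℕ} {Mbar : Type*} [TopologicalSpace Mbar]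
  [ChartedSpace (EuclideanSpace ℝ (Fin (n + 2))) Mbar] [IsManifold (𝓡 (n + 2)) ∞ Mbar]
  {G : LorentzMetric (n + 2) Mbar} {M : Type*} [TopologicalSpace M]
  [ChartedSpace (EuclideanSpace ℝ (Fin (n + 1))) M] [IsManifold (𝓡 (n + 1)) ∞ M]
  {H : Hypersurface G M}

namespace Screen

variable (Sc : H.Screen) {X X' Y Z : VField (n + 1) M}

lemma Q_d (p : M) (v : TangentSpace (𝓡 (n + 1)) p) : Sc.Q p (H.d p v) = v :=
  LinearMap.linearProjOfIsCompl_apply_left _ _ _ _ v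

lemma diffAlong_d (hY : SmoothField Y) (p : M) :
    LorentzMetric.DiffAlong (k := n + 1) H.toFun (fun q ↦ H.d q (Y q)) p :=
  LorentzMetric.diffAlong_mfderiv H.smooth hY p

lemma nabla_add_left (X X' Y : VField (n + 1) M) (p : M) :
    Sc.nabla (fun q ↦ X q + X' q) Y p = Sc.nabla X Y p + Sc.nabla X' Y p := by
  simp only [nabla]
  rw [LorentzMetric.covAlong_add_left, map_add]

lemma nabla_add_right (X : VField (n + 1) M) (hY : SmoothField Y) (hZ : SmoothField Z) (p : M) :
    Sc.nabla X (fun q ↦ Y q + Z q) p = Sc.nabla X Y p + Sc.nabla X Z p := by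
  simp only [nabla, map_add]
  rw [LorentzMetric.covAlong_add_right G (diffAlong_d hY p) (diffAlong_d hZ p), map_add]

lemma nabla_smul_right {r : M → ℝ} (hr : ContMDiff (𝓡 (n + 1)) 𝓘(ℝ, ℝ) ∞ r)
    (X : VField (n + 1) M) (hY : SmoothField Y) (p : M) :
    Sc.nabla X (fun q ↦ r q • Y q) p = vdiff r p (X p) • Y p + r p • Sc.nabla X Y p := by
  simp only [nabla, map_smul]
  rw [LorentzMetric.covAlong_smul_right G ((hr p).mdifferentiableAt (by simp))
    (diffAlong_d hY p), map_add, map_smul, map_smul, Q_d]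

/-- The induced connection is torsion free. -/
lemma dchart_nabla_sub_nabla (hX : SmoothField X) (hY : SmoothField Y) {c p : M}
    (hp : p ∈ (extChartAt (𝓡 (n + 1)) c).source) :
    dchart c p (Sc.nabla X Y p - Sc.nabla Y X p) =
      LorentzMetric.chartBracket c X Y (extChartAt (𝓡 (n + 1)) c p) := by
  obtain ⟨w, hw⟩ := dchart_surjective hp
    (LorentzMetric.chartBracket c X Y (extChartAt (𝓡 (n + 1)) c p))
  have h : Sc.nabla X Y p - Sc.nabla Y X p = w := by
    have h1 := LorentzMetric.covAlong_sub_covAlong G H.smooth hX hY hp hw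
    rw [nabla, nabla, ← map_sub]
    exact (congrArg (Sc.Q p) h1).trans (Sc.Q_d p w)
  rw [h, hw]

variable {Sc}

/-- The projection `Q` loses nothing when the second fundamental form vanishes, so metric
compatibility descends from the ambient connection. -/
lemma IsTotallyGeodesic.d_nabla (hgeod : Sc.IsTotallyGeodesic) (hX : SmoothField X)
    (hY : SmoothField Y) (p : M) :
    H.d p (Sc.nabla X Y p) = G.covAlong H.toFun (fun q ↦ H.d q (Y q)) p (X p) :=
  (sub_eq_zero.mp (hgeod X Y hX hY p)).symm

/-- On a totally geodesic hypersurface, the induced connection is compatible with the metric. -/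
lemma IsTotallyGeodesic.vdiff_g (hgeod : Sc.IsTotallyGeodesic) (hX : SmoothField X)
    (hY : SmoothField Y) (hZ : SmoothField Z) (p : M) :
    vdiff (fun q ↦ H.g q (Y q) (Z q)) p (X p) =
      H.g p (Sc.nabla X Y p) (Z p) + H.g p (Y p) (Sc.nabla X Z p) := by
  simp only [g]
  rw [hgeod.d_nabla hX hY, hgeod.d_nabla hX hZ]
  exact LorentzMetric.vdiff_inner G H.smooth (diffAlong_d hY p) (diffAlong_d hZ p) (X p)

end Screen

end Hypersurface

/-! ### The screen decomposition and `A^∇`-tensors -/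

namespace Hypersurface

variable {n : ℕ} {Mbar : Type*} [TopologicalSpace Mbar]
  [ChartedSpace (EuclideanSpace ℝ (Fin (n + 2))) Mbar] [IsManifold (𝓡 (n + 2)) ∞ Mbar]
  {G : LorentzMetric (n + 2) Mbar} {M : Type*} [TopologicalSpace M]
  [ChartedSpace (EuclideanSpace ℝ (Fin (n + 1))) M] [IsManifold (𝓡 (n + 1)) ∞ M]
  {H : Hypersurface G M}

namespace Screen

variable (Sc : H.Screen)

lemma η_ξ (p : M) : Sc.η p (H.ξ p) = 1 := Sc.N_ξ p

lemma η_of_mem {p : M} {v : TangentSpace (𝓡 (n + 1)) p} (hv : v ∈ Sc.dist p) : Sc.η p v = 0 :=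
  (Sc.exists_transversal p).choose_spec.2.2 v hv

lemma P_mem (p : M) (v : TangentSpace (𝓡 (n + 1)) p) : Sc.P p v ∈ Sc.dist p :=
  Submodule.projection_apply_mem (Sc.isCompl p) v

lemma P_of_mem {p : M} {v : TangentSpace (𝓡 (n + 1)) p} (hv : v ∈ Sc.dist p) : Sc.P p v = v :=
  Submodule.projection_apply_left (Sc.isCompl p) ⟨v, hv⟩

lemma P_ξ (p : M) : Sc.P p (H.ξ p) = 0 :=
  Submodule.projection_apply_right (Sc.isCompl p) ⟨H.ξ p, H.ξ_mem_rad p⟩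

lemma exists_eq_smul_ξ {p : M} {v : TangentSpace (𝓡 (n + 1)) p} (hv : v ∈ H.rad p) :
    ∃ c : ℝ, v = c • H.ξ p := (H.g_nonneg_aux p v).2 (hv v)

lemma sub_P_mem_rad (p : M) (v : TangentSpace (𝓡 (n + 1)) p) : v - Sc.P p v ∈ H.rad p := by
  obtain ⟨a, ha, b, hb, rfl⟩ := Submodule.mem_sup.mp
    ((Sc.isCompl p).sup_eq_top ▸ Submodule.mem_top : v ∈ Sc.dist p ⊔ H.rad p)
  obtain ⟨c, rfl⟩ := exists_eq_smul_ξ hb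
  rw [map_add, Sc.P_of_mem ha, map_smul, P_ξ, smul_zero, add_zero, add_sub_cancel_left]
  exact hb

lemma eq_P_add (p : M) (v : TangentSpace (𝓡 (n + 1)) p) :
    v = Sc.P p v + Sc.η p v • H.ξ p := by
  obtain ⟨c, hc⟩ := exists_eq_smul_ξ (Sc.sub_P_mem_rad p v)
  have h := congrArg (Sc.η p) hc
  rw [map_sub, map_smul, Sc.η_of_mem (Sc.P_mem p v), η_ξ, smul_eq_mul, mul_one, sub_zero] at h
  rw [h, ← hc, add_sub_cancel]

lemma P_eq_self_of_η_eq_zero {p : M} {v : TangentSpace (𝓡 (n + 1)) p} (hv : Sc.η p v = 0) :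
    Sc.P p v = v := by
  have := Sc.eq_P_add p v
  rw [hv, zero_smul, add_zero] at this
  exact this.symm

/-- The form `g` is semidefinite with null vectors the multiples of `ξ`, and these are detected by
`η`. -/
lemma eq_zero_of_g_eq_zero {p : M} {v : TangentSpace (𝓡 (n + 1)) p} (hv : Sc.η p v = 0)
    (h : H.g p v v = 0) : v = 0 := by
  obtain ⟨c, rfl⟩ := (H.g_nonneg_aux p v).2 h
  rw [map_smul, η_ξ, smul_eq_mul, mul_one] at hv
  rw [hv, zero_smul]

variable {Sc} {k : ℕ} {S : ∀ p : M, TangentSpace (𝓡 (n + 1)) p →L[ℝ] TangentSpace (𝓡 (n + 1)) p}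
  {lam : Fin (k + 1) → M → ℝ}

lemma mem_eigenDistrib {f : M → ℝ} {p : M} {v : TangentSpace (𝓡 (n + 1)) p} :
    v ∈ eigenDistrib S f p ↔ S p v = f p • v := Module.End.mem_eigenspace_iff

/-- `S` preserves the screen and multiplies `ξ` by `lam 0`. -/
lemma IsATensor.η_apply (hS : Sc.IsATensor S)
    (hD0 : ∀ p, eigenDistrib S (lam 0) p = H.rad p) (p : M) (v : TangentSpace (𝓡 (n + 1)) p) :
    Sc.η p (S p v) = lam 0 p * Sc.η p v := by
  have hξ : S p (H.ξ p) = lam 0 p • H.ξ p := by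
    rw [← mem_eigenDistrib, hD0]; exact H.ξ_mem_rad p
  conv_lhs => rw [Sc.eq_P_add p v]
  rw [map_add, map_smul, hξ, ← hS.screen_preserving, map_add, Sc.η_of_mem (Sc.P_mem _ _),
    map_smul, map_smul, η_ξ, smul_eq_mul, smul_eq_mul]
  ring

/-- The form `X^♭(Y)` is positive definite and `S` is self-adjoint for it: symmetry for `g` handles
one summand, and `η ∘ S = lam 0 • η` the other. -/
lemma IsATensor.iSup_eigenspace (hS : Sc.IsATensor S)
    (hD0 : ∀ p, eigenDistrib S (lam 0) p = H.rad p) (p : M) :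
    ⨆ c, Module.End.eigenspace (S p).toLinearMap c = ⊤ := by
  have h0 : ∀ v, 0 ≤ Sc.flat p v v := fun v ↦ by
    rw [flat_apply]
    exact add_nonneg (H.g_nonneg_aux p v).1 (mul_self_nonneg _)
  refine iSup_eigenspace_eq_top_of_selfAdjoint (Sc.flat p) (fun v w ↦ ?_) h0 (fun v hv ↦ ?_) _
    fun v w ↦ ?_
  · rw [flat_apply, flat_apply, g_symm, mul_comm]
  · rw [flat_apply] at hv
    have h1 := (H.g_nonneg_aux p v).1
    have h2 := mul_self_nonneg (Sc.η p v)
    exact Sc.eq_zero_of_g_eq_zero (mul_self_eq_zero.mp (by linarith)) (by linarith)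
  · change Sc.flat p (S p v) w = Sc.flat p v (S p w)
    rw [flat_apply, flat_apply, hS.symmetric, hS.η_apply hD0, hS.η_apply hD0]
    ring

/-- Computing `η (S v)` in two ways gives `(lam i - lam 0) η v = 0`. -/
lemma IsATensor.η_eq_zero (hS : Sc.IsATensor S) (hlam : IsEigenfunctions S lam)
    (hD0 : ∀ p, eigenDistrib S (lam 0) p = H.rad p) {i : Fin (k + 1)} (hi : i ≠ 0) {p : M}
    {v : TangentSpace (𝓡 (n + 1)) p} (hv : v ∈ eigenDistrib S (lam i) p) : Sc.η p v = 0 := by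
  have h1 := hS.η_apply hD0 p v
  rw [mem_eigenDistrib.mp hv, map_smul, smul_eq_mul] at h1
  have h2 : lam i p - lam 0 p ≠ 0 := sub_ne_zero.mpr ((hlam.distinct p).ne hi)
  exact (mul_eq_zero.mp (by linear_combination h1 :
    (lam i p - lam 0 p) * Sc.η p v = 0)).resolve_left h2

lemma eigenProj_mem (hS : Sc.IsATensor S) (hlam : IsEigenfunctions S lam)
    (hD0 : ∀ p, eigenDistrib S (lam 0) p = H.rad p) (i : Fin (k + 1)) (p : M)
    (v : TangentSpace (𝓡 (n + 1)) p) :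
    eigenProj (S p) (fun j ↦ lam j p) i v ∈ eigenDistrib S (lam i) p :=
  mem_eigenDistrib.mpr (apply_eigenProj (hlam.distinct p) (fun c hc ↦ (hlam.spectrum p c).mp hc)
    (hS.iSup_eigenspace hD0 p) i v)

lemma eigenProj_of_mem (hlam : IsEigenfunctions S lam) {i : Fin (k + 1)} {p : M}
    {v : TangentSpace (𝓡 (n + 1)) p} (hv : v ∈ eigenDistrib S (lam i) p) :
    eigenProj (S p) (fun j ↦ lam j p) i v = v :=
  eigenProj_apply_of_eigen (hlam.distinct p) (mem_eigenDistrib.mp hv)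

/-- Every vector of an eigendistribution extends to a global section. -/
lemma exists_isSection_eq [T2Space M] (hS : Sc.IsATensor S) (hlam : IsEigenfunctions S lam)
    (hD0 : ∀ p, eigenDistrib S (lam 0) p = H.rad p) {i : Fin (k + 1)} {p : M}
    {v : TangentSpace (𝓡 (n + 1)) p} (hv : v ∈ eigenDistrib S (lam i) p) :
    ∃ X : VField (n + 1) M, IsSection (eigenDistrib S (lam i)) X ∧ X p = v := by
  obtain ⟨X, hX, rfl⟩ := exists_smoothField_eq p v
  exact ⟨_, ⟨SmoothField.eigenProj hS.smooth hlam.smooth hlam.distinct i hX,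
    fun q ↦ eigenProj_mem hS hlam hD0 i q _⟩, eigenProj_of_mem hlam hv⟩

lemma flat_grad (f : M → ℝ) (p : M) (v : TangentSpace (𝓡 (n + 1)) p) :
    Sc.flat p (Sc.grad f p) v = vdiff f p v := by
  have h := (Sc.flatEquiv p).apply_symm_apply
    (mfderiv (𝓡 (n + 1)) 𝓘(ℝ, ℝ) f p : TangentSpace (𝓡 (n + 1)) p →L[ℝ] ℝ).toLinearMap
  exact congrArg (fun L ↦ L v) h

/-- In `df(v) = g(∇^g f, v) + η(∇^g f) η(v)` a radical gradient kills the first term and `η v = 0`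
the second. -/
lemma vdiff_eq_zero_of_grad {f : M → ℝ} {p : M} (hf : Sc.grad f p ∈ H.rad p)
    {v : TangentSpace (𝓡 (n + 1)) p} (hv : Sc.η p v = 0) : vdiff f p v = 0 := by
  rw [← flat_grad (Sc := Sc), flat_apply, hv, mul_zero, add_zero]
  exact hf v

lemma covEnd_of_eigen {f : M → ℝ} (hf : ContMDiff (𝓡 (n + 1)) 𝓘(ℝ, ℝ) ∞ f)
    (X : VField (n + 1) M) {Y : VField (n + 1) M} (hY : IsSection (eigenDistrib S f) Y) (p : M) :
    Sc.covEnd S X Y p =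
      vdiff f p (X p) • Y p + (f p • Sc.nabla X Y p - S p (Sc.nabla X Y p)) := by
  have h : (fun q ↦ S q (Y q)) = fun q ↦ f q • Y q :=
    funext fun q ↦ mem_eigenDistrib.mp (hY.2 q)
  rw [covEnd, h, Sc.nabla_smul_right hf X hY.1]
  abel

lemma covEnd_add_left (X X' Y : VField (n + 1) M) (p : M) :
    Sc.covEnd S (fun q ↦ X q + X' q) Y p = Sc.covEnd S X Y p + Sc.covEnd S X' Y p := by
  simp only [covEnd]
  rw [nabla_add_left, nabla_add_left, map_add]
  abel

lemma covEnd_add_right (hS : SmoothEnd S) (X : VField (n + 1) M) {Y Z : VField (n + 1) M}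
    (hY : SmoothField Y) (hZ : SmoothField Z) (p : M) :
    Sc.covEnd S X (fun q ↦ Y q + Z q) p = Sc.covEnd S X Y p + Sc.covEnd S X Z p := by
  simp only [covEnd, map_add]
  rw [Sc.nabla_add_right X (hS.smoothField hY) (hS.smoothField hZ), Sc.nabla_add_right X hY hZ,
    map_add]
  abel

/-- The polarized form of the Killing condition on an `A^∇`-tensor. -/
lemma IsATensor.killing_polarized (hS : Sc.IsATensor S) {X Y Z : VField (n + 1) M}
    (hX : SmoothField X) (hY : SmoothField Y) (hZ : SmoothField Z) (p : M) :
    Sc.flat p (X p) (Sc.covEnd S Y Z p) + Sc.flat p (X p) (Sc.covEnd S Z Y p) +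
      (Sc.flat p (Y p) (Sc.covEnd S X Z p) + Sc.flat p (Y p) (Sc.covEnd S Z X p)) +
      (Sc.flat p (Z p) (Sc.covEnd S X Y p) + Sc.flat p (Z p) (Sc.covEnd S Y X p)) = 0 := by
  have hXY := hX.add hY
  -- For the cubic form f(X) = X^♭(∇S(X, X)), the claim is f(X+Y+Z) - f(X+Y) - f(X+Z) - f(Y+Z) +
  -- f(X) + f(Y) + f(Z) = 0.
  have h1 := hS.killing _ hX p
  have h2 := hS.killing _ hY p
  have h3 := hS.killing _ hZ p
  have h4 := hS.killing _ hXY p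
  have h5 := hS.killing _ (hX.add hZ) p
  have h6 := hS.killing _ (hY.add hZ) p
  have h7 := hS.killing _ (hXY.add hZ) p
  simp only [covEnd_add_left, covEnd_add_right hS.smooth _ hXY hZ,
    covEnd_add_right hS.smooth _ hX hY, covEnd_add_right hS.smooth _ hX hZ,
    covEnd_add_right hS.smooth _ hY hZ, map_add, LinearMap.add_apply] at h4 h5 h6 h7
  linarith

end Screen

end Hypersurface

/-! ### Frobenius' theorem for eigendistributions -/

section ChartProj

variable {m k : ℕ} {M : Type*} [TopologicalSpace M]
  [ChartedSpace (EuclideanSpace ℝ (Fin m)) M] [IsManifold (𝓡 m) ∞ M]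
  {S : ∀ x : M, TangentSpace (𝓡 m) x →L[ℝ] TangentSpace (𝓡 m) x} {lam : Fin (k + 1) → M → ℝ}

/-- The spectral projector of `S` for the eigenfunction `lam i`, read in the chart around `c`. -/
def chartProj (c : M) (S : ∀ x : M, TangentSpace (𝓡 m) x →L[ℝ] TangentSpace (𝓡 m) x)
    (lam : Fin (k + 1) → M → ℝ) (i : Fin (k + 1)) (z : EuclideanSpace ℝ (Fin m)) :
    EuclideanSpace ℝ (Fin m) →L[ℝ] EuclideanSpace ℝ (Fin m) :=
  eigenProj (chartEnd c S z) (fun j ↦ lam j ((extChartAt (𝓡 m) c).symm z)) i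

variable {c : M} {z : EuclideanSpace ℝ (Fin m)} {i : Fin (k + 1)}

lemma contDiffOn_chartProj (hS : SmoothEnd S) (hlam : IsEigenfunctions S lam) :
    ContDiffOn ℝ ∞ (chartProj c S lam i) (extChartAt (𝓡 m) c).target :=
  (contDiffOn_chartEnd hS).eigenProj (fun j ↦ contMDiffOn_symm_comp (hlam.smooth j) c)
    (fun _ _ ↦ hlam.distinct _) i

lemma chartProj_dchart (hz : z ∈ (extChartAt (𝓡 m) c).target)
    (v : TangentSpace (𝓡 m) ((extChartAt (𝓡 m) c).symm z)) :
    chartProj c S lam i z (dchart c _ v) = dchart c _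
      (eigenProj (S ((extChartAt (𝓡 m) c).symm z))
        (fun j ↦ lam j ((extChartAt (𝓡 m) c).symm z)) i v) :=
  eigenProd_intertwine (map_sub _) (map_smul _) (chartEnd_dchart S hz) _ _ _ v

lemma chartProj_idem
    (hE : ∀ p v, eigenProj (S p) (fun j ↦ lam j p) i v ∈ eigenDistrib S (lam i) p)
    (hE' : ∀ p, ∀ v ∈ eigenDistrib S (lam i) p, eigenProj (S p) (fun j ↦ lam j p) i v = v)
    (hz : z ∈ (extChartAt (𝓡 m) c).target) (a : EuclideanSpace ℝ (Fin m)) :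
    chartProj c S lam i z (chartProj c S lam i z a) = chartProj c S lam i z a := by
  obtain ⟨v, rfl⟩ := dchart_surjective ((extChartAt (𝓡 m) c).map_target hz) a
  rw [chartProj_dchart hz, chartProj_dchart hz, hE' _ _ (hE _ _)]

lemma chartProj_dchart_eq_iff
    (hE : ∀ p v, eigenProj (S p) (fun j ↦ lam j p) i v ∈ eigenDistrib S (lam i) p)
    (hE' : ∀ p, ∀ v ∈ eigenDistrib S (lam i) p, eigenProj (S p) (fun j ↦ lam j p) i v = v)
    {q : M} (hq : q ∈ (extChartAt (𝓡 m) c).source) (v : TangentSpace (𝓡 m) q) :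
    chartProj c S lam i (extChartAt (𝓡 m) c q) (dchart c q v) = dchart c q v ↔
      v ∈ eigenDistrib S (lam i) q := by
  obtain ⟨z, hz, rfl⟩ : ∃ z ∈ (extChartAt (𝓡 m) c).target, (extChartAt (𝓡 m) c).symm z = q :=
    ⟨_, (extChartAt (𝓡 m) c).map_source hq, (extChartAt (𝓡 m) c).left_inv hq⟩
  rw [(extChartAt (𝓡 m) c).right_inv hz, chartProj_dchart hz]
  refine ⟨fun h ↦ ?_, fun h ↦ by rw [hE' _ _ h]⟩
  rw [← dchart_injective hq h]
  exact hE _ _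

/-- The component of the bracket of two sections transverse to the eigendistribution. -/
lemma chartBracket_sub_chartProj (hS : SmoothEnd S) (hlam : IsEigenfunctions S lam)
    (hE' : ∀ p, ∀ v ∈ eigenDistrib S (lam i) p, eigenProj (S p) (fun j ↦ lam j p) i v = v)
    (hz : z ∈ (extChartAt (𝓡 m) c).target) {X Y : VField m M}
    (hX : IsSection (eigenDistrib S (lam i)) X) (hY : IsSection (eigenDistrib S (lam i)) Y) :
    LorentzMetric.chartBracket c X Y z -
      chartProj c S lam i z (LorentzMetric.chartBracket c X Y z) =
      fderiv ℝ (chartProj c S lam i) z (chartField c X z) (chartField c Y z) -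
      fderiv ℝ (chartProj c S lam i) z (chartField c Y z) (chartField c X z) := by
  have hd : HasFDerivAt (chartProj c S lam i) (fderiv ℝ (chartProj c S lam i) z) z :=
    (((contDiffOn_chartProj hS hlam).contDiffAt
      ((isOpen_extChartAt_target c).mem_nhds hz)).differentiableAt (by simp)).hasFDerivAt
  -- Differentiating `E Y = Y` along `a` gives `(DE a) Y = (1 - E) (DY a)`.
  have key : ∀ {Y : VField m M}, IsSection (eigenDistrib S (lam i)) Y → ∀ a,
      fderiv ℝ (chartProj c S lam i) z a (chartField c Y z) = fderiv ℝ (chartField c Y) z a -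
        chartProj c S lam i z (fderiv ℝ (chartField c Y) z a) := by
    intro Y hY a
    have h1 : HasFDerivAt (chartField c Y) (fderiv ℝ (chartField c Y) z) z :=
      (((contDiffOn_chartField (hY.1.smoothFieldOn univ) (subset_univ _)).contDiffAt
        ((isOpen_extChartAt_target c).mem_nhds hz)).differentiableAt (by simp)).hasFDerivAt
    have h2 := (hd.clm_apply h1).unique (h1.congr_of_eventuallyEq
      (eventually_of_mem ((isOpen_extChartAt_target c).mem_nhds hz) fun y hy ↦ by
        change chartProj c S lam i y (dchart c _ (Y _)) = dchart c _ (Y _)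
        rw [chartProj_dchart hy, hE' _ _ (hY.2 _)]))
    have h3 := congrArg (fun L ↦ L a) h2
    exact eq_sub_of_add_eq' h3
  rw [key hX, key hY, LorentzMetric.chartBracket, map_sub]
  abel

/-- **Frobenius' theorem** for the eigendistributions. -/
lemma isIntegrable_of_chartBracket (hS : SmoothEnd S) (hlam : IsEigenfunctions S lam)
    (hE : ∀ p v, eigenProj (S p) (fun j ↦ lam j p) i v ∈ eigenDistrib S (lam i) p)
    (hE' : ∀ p, ∀ v ∈ eigenDistrib S (lam i) p, eigenProj (S p) (fun j ↦ lam j p) i v = v)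
    (hex : ∀ p, ∀ v ∈ eigenDistrib S (lam i) p,
      ∃ X : VField m M, IsSection (eigenDistrib S (lam i)) X ∧ X p = v)
    (hbr : ∀ X Y : VField m M, IsSection (eigenDistrib S (lam i)) X →
      IsSection (eigenDistrib S (lam i)) Y → ∀ c, ∀ z ∈ (extChartAt (𝓡 m) c).target,
        chartProj c S lam i z (LorentzMetric.chartBracket c X Y z) =
          LorentzMetric.chartBracket c X Y z) :
    IsIntegrable (eigenDistrib S (lam i)) := by
  intro p
  have hsymm : ∀ y ∈ (extChartAt (𝓡 m) p).target, ∀ a b, chartProj p S lam i y a = a →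
      chartProj p S lam i y b = b → fderiv ℝ (chartProj p S lam i) y a b =
        fderiv ℝ (chartProj p S lam i) y b a := by
    intro y hy a b ha hb
    have hq := (extChartAt (𝓡 m) p).map_target hy
    obtain ⟨v, rfl⟩ := dchart_surjective hq a
    obtain ⟨w, rfl⟩ := dchart_surjective hq b
    have hv := (chartProj_dchart_eq_iff hE hE' hq v).mp
      (by rwa [(extChartAt (𝓡 m) p).right_inv hy])
    have hw := (chartProj_dchart_eq_iff hE hE' hq w).mp
      (by rwa [(extChartAt (𝓡 m) p).right_inv hy])
    -- The condition on the projector is pointwise in `a` and `b`, so any sections extending these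
    -- vectors may be used to express it by a bracket.
    obtain ⟨X, hX, rfl⟩ := hex _ v hv
    obtain ⟨Y, hY, rfl⟩ := hex _ w hw
    have h5 := chartBracket_sub_chartProj hS hlam hE' hy hX hY
    rw [hbr X Y hX hY p y hy, sub_self] at h5
    exact (sub_eq_zero.mp h5.symm)
  obtain ⟨r, U, φ, hU, h0, hφ0, hφ, hφU⟩ := exists_integral_manifold_of_fderiv_projector_symm
    (isOpen_extChartAt_target p) (contDiffOn_chartProj (c := p) (i := i) hS hlam)
    (fun y hy a ↦ chartProj_idem hE hE' hy a) hsymm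
    (mem_extChartAt_target (I := 𝓡 m) p)
  refine ⟨r, U, (extChartAt (𝓡 m) p).symm ∘ φ, hU, h0, ?_, ?_, fun u hu ↦ ?_⟩
  · rw [Function.comp_apply, hφ0, extChartAt_to_inv]
  · exact (contMDiffOn_extChartAt_symm p).comp hφ.contMDiffOn fun u hu ↦ (hφU u hu).1
  obtain ⟨hΩ, hinj, hran⟩ := hφU u hu
  have hd : mfderiv (𝓡 r) (𝓡 m) ((extChartAt (𝓡 m) p).symm ∘ φ) u =
      (dchartSymm p (φ u)).comp (fderiv ℝ φ u) := by
    have h1 : MDifferentiableAt 𝓘(ℝ, EuclideanSpace ℝ (Fin m)) (𝓡 m)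
        (extChartAt (𝓡 m) p).symm (φ u) :=
      ((contMDiffOn_extChartAt_symm p).contMDiffAt
        ((isOpen_extChartAt_target p).mem_nhds hΩ)).mdifferentiableAt (n := ∞) (by simp)
    have h2 : DifferentiableAt ℝ φ u :=
      (hφ.contDiffAt (hU.mem_nhds hu)).differentiableAt (by simp)
    exact (h1.hasMFDerivAt.comp u h2.hasFDerivAt.hasMFDerivAt).mfderiv
  have hinv : ∀ a, dchart p _ (dchartSymm p (φ u) a) = a := dchart_dchartSymm hΩ
  have hq := (extChartAt (𝓡 m) p).map_target hΩ
  rw [hd]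
  refine ⟨fun a b hab ↦ hinj ?_, le_antisymm ?_ fun v hv ↦ ?_⟩
  · have h3 := congrArg (dchart p _) (show dchartSymm p (φ u) (fderiv ℝ φ u a) =
      dchartSymm p (φ u) (fderiv ℝ φ u b) from hab)
    rwa [hinv, hinv] at h3
  · rintro _ ⟨a, rfl⟩
    obtain ⟨b, hb⟩ : fderiv ℝ φ u a ∈ LinearMap.range (chartProj p S lam i (φ u)).toLinearMap :=
      hran ▸ ⟨a, rfl⟩
    change dchartSymm p (φ u) (fderiv ℝ φ u a) ∈ eigenDistrib S (lam i) _
    rw [← chartProj_dchart_eq_iff hE hE' hq, (extChartAt (𝓡 m) p).right_inv hΩ, hinv, ← hb]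
    exact chartProj_idem hE hE' hΩ b
  · have h4 := (chartProj_dchart_eq_iff hE hE' hq v).mpr hv
    rw [(extChartAt (𝓡 m) p).right_inv hΩ] at h4
    obtain ⟨a, ha⟩ : dchart p _ v ∈ LinearMap.range (fderiv ℝ φ u).toLinearMap :=
      hran ▸ ⟨_, h4⟩
    refine ⟨a, ?_⟩
    change dchartSymm p (φ u) (fderiv ℝ φ u a) = v
    rw [← dchartSymm_dchart hΩ v]
    exact congrArg _ ha

/-- Sections of an integrable eigendistribution are closed under brackets. -/
lemma chartProj_chartBracket_of_isIntegrable (hS : SmoothEnd S) (hlam : IsEigenfunctions S lam)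
    (hE : ∀ p v, eigenProj (S p) (fun j ↦ lam j p) i v ∈ eigenDistrib S (lam i) p)
    (hE' : ∀ p, ∀ v ∈ eigenDistrib S (lam i) p, eigenProj (S p) (fun j ↦ lam j p) i v = v)
    (hint : IsIntegrable (eigenDistrib S (lam i))) {X Y : VField m M}
    (hX : IsSection (eigenDistrib S (lam i)) X) (hY : IsSection (eigenDistrib S (lam i)) Y)
    (p : M) :
    chartProj p S lam i (extChartAt (𝓡 m) p p)
        (LorentzMetric.chartBracket p X Y (extChartAt (𝓡 m) p p)) =
      LorentzMetric.chartBracket p X Y (extChartAt (𝓡 m) p p) := by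
  obtain ⟨r, U, φ, hU, h0, rfl, hφ, hφU⟩ := hint p
  have hp := mem_extChartAt_source (I := 𝓡 m) (φ 0)
  have ht := mem_extChartAt_target (I := 𝓡 m) (φ 0)
  have hφat : ∀ u ∈ U, ContMDiffAt (𝓡 r) (𝓡 m) ∞ φ u := fun u hu ↦
    (hφ u hu).contMDiffAt (hU.mem_nhds hu)
  have hev : ∀ᶠ u in 𝓝 (0 : EuclideanSpace ℝ (Fin r)),
      u ∈ U ∧ φ u ∈ (extChartAt (𝓡 m) (φ 0)).source :=
    (hU.eventually_mem h0).and ((hφat 0 h0).continuousAt.eventually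
      ((isOpen_extChartAt_source (φ 0)).mem_nhds hp))
  have hderiv : ∀ u ∈ U, φ u ∈ (extChartAt (𝓡 m) (φ 0)).source → ∀ v,
      fderiv ℝ (extChartAt (𝓡 m) (φ 0) ∘ φ) u v =
        dchart (φ 0) (φ u) (mfderiv (𝓡 r) (𝓡 m) φ u v) := by
    intro u hu hs v
    have h1 : MDifferentiableAt (𝓡 m) 𝓘(ℝ, EuclideanSpace ℝ (Fin m)) (extChartAt (𝓡 m) (φ 0))
        (φ u) := mdifferentiableAt_extChartAt (by rwa [extChartAt_source] at hs)
    have h2 : mfderiv (𝓡 r) 𝓘(ℝ, EuclideanSpace ℝ (Fin m)) (extChartAt (𝓡 m) (φ 0) ∘ φ) u = _ :=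
      mfderiv_comp u h1 ((hφat u hu).mdifferentiableAt (by simp))
    rw [mfderiv_eq_fderiv] at h2
    exact congrArg (fun L : EuclideanSpace ℝ (Fin r) →L[ℝ] EuclideanSpace ℝ (Fin m) ↦ L v) h2
  have hsm : ContDiffAt ℝ 2 (extChartAt (𝓡 m) (φ 0) ∘ φ) 0 := by
    refine contDiffAt_infty.mp ?_ 2
    rw [← contMDiffAt_iff_contDiffAt]
    exact ContMDiffAt.comp 0 (contMDiffAt_extChartAt'
      (mem_chart_source _ _)) (hφat 0 h0)
  have hd : DifferentiableAt ℝ (chartProj (φ 0) S lam i) ((extChartAt (𝓡 m) (φ 0) ∘ φ) 0) := by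
    exact ((contDiffOn_chartProj hS hlam).contDiffAt
      ((isOpen_extChartAt_target (φ 0)).mem_nhds ht)).differentiableAt (by simp)
  have hsymm := fderiv_projector_symm_of_integral hd hsm (hev.mono fun u hu v ↦ by
    rw [hderiv u hu.1 hu.2]
    refine (chartProj_dchart_eq_iff hE hE' hu.2 _).mpr ?_
    rw [← (hφU u hu.1).2]
    exact ⟨v, rfl⟩)
  -- Tangent vectors of the integral manifold exhaust the distribution at this point, so the
  -- symmetry along `φ` applies to the values of `X` and `Y`.
  have hlift : ∀ v ∈ eigenDistrib S (lam i) (φ 0), ∃ a,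
      fderiv ℝ (extChartAt (𝓡 m) (φ 0) ∘ φ) 0 a = dchart (φ 0) (φ 0) v := by
    intro v hv
    obtain ⟨a, rfl⟩ : v ∈ LinearMap.range (mfderiv (𝓡 r) (𝓡 m) φ 0).toLinearMap :=
      (hφU 0 h0).2 ▸ hv
    exact ⟨a, hderiv 0 h0 hp a⟩
  have e1 : ∀ X : VField m M, chartField (φ 0) X (extChartAt (𝓡 m) (φ 0) (φ 0)) =
      dchart (φ 0) (φ 0) (X (φ 0)) := by
    intro X
    rw [chartField, extChartAt_to_inv]
  obtain ⟨a, ha⟩ := hlift _ (hX.2 _)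
  obtain ⟨b, hb⟩ := hlift _ (hY.2 _)
  have h5 := chartBracket_sub_chartProj hS hlam hE' ht hX hY
  have h6 := hsymm a b
  rw [ha, hb] at h6
  rw [Function.comp_apply] at h6
  rw [e1, e1, h6, sub_self] at h5
  exact (sub_eq_zero.mp h5).symm

end ChartProj

/-! ### Covariant derivative of `S` along an eigendistribution -/

namespace Hypersurface

variable {n : ℕ} {Mbar : Type*} [TopologicalSpace Mbar]
  [ChartedSpace (EuclideanSpace ℝ (Fin (n + 2))) Mbar] [IsManifold (𝓡 (n + 2)) ∞ Mbar]
  {G : LorentzMetric (n + 2) Mbar} {M : Type*} [TopologicalSpace M]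
  [ChartedSpace (EuclideanSpace ℝ (Fin (n + 1))) M] [IsManifold (𝓡 (n + 1)) ∞ M]
  {H : Hypersurface G M}

lemma g_sub_left (p : M) (u v w : TangentSpace (𝓡 (n + 1)) p) :
    H.g p (u - v) w = H.g p u w - H.g p v w := by
  simp only [g, map_sub, sub_apply]

lemma g_smul_left (p : M) (r : ℝ) (v w : TangentSpace (𝓡 (n + 1)) p) :
    H.g p (r • v) w = r * H.g p v w := by
  simp only [g, map_smul, smul_apply, smul_eq_mul]

namespace Screen

variable {Sc : H.Screen} {k : ℕ}
  {S : ∀ p : M, TangentSpace (𝓡 (n + 1)) p →L[ℝ] TangentSpace (𝓡 (n + 1)) p}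
  {lam : Fin (k + 1) → M → ℝ} {i : Fin (k + 1)} {X Y Z : VField (n + 1) M}

/-- `∇_X S` is symmetric with respect to `g`. -/
lemma IsATensor.g_covEnd (hS : Sc.IsATensor S) (hgeod : Sc.IsTotallyGeodesic)
    (hX : SmoothField X) (hY : SmoothField Y) (hZ : SmoothField Z) (p : M) :
    H.g p (Sc.covEnd S X Y p) (Z p) = H.g p (Sc.covEnd S X Z p) (Y p) := by
  -- Both sides of `g(SY, Z) = g(Y, SZ)` are differentiated along `X`.
  have h1 := hgeod.vdiff_g hX (hS.smooth.smoothField hY) hZ p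
  have h2 := hgeod.vdiff_g hX hY (hS.smooth.smoothField hZ) p
  simp only [hS.symmetric] at h1
  rw [h1] at h2
  rw [covEnd, covEnd, g_sub_left, g_sub_left, hS.symmetric, hS.symmetric,
    g_symm _ _ (Sc.nabla X (fun q ↦ S q (Z q)) p), g_symm _ _ (Sc.nabla X Z p), hS.symmetric]
  linarith

/-- Sections of `D_i` differentiate `lam i` trivially when `lam i` has a radical gradient, so
that `∇S(X, Y) = (lam i - S) ∇_X Y`. -/
lemma covEnd_eq_of_grad (hlam : IsEigenfunctions S lam)
    (hgrad : ∀ p, Sc.grad (lam i) p ∈ H.rad p) {p : M} (hX : Sc.η p (X p) = 0)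
    (hY : IsSection (eigenDistrib S (lam i)) Y) :
    Sc.covEnd S X Y p = lam i p • Sc.nabla X Y p - S p (Sc.nabla X Y p) := by
  rw [covEnd_of_eigen (hlam.smooth i) X hY, vdiff_eq_zero_of_grad (hgrad p) hX, zero_smul,
    zero_add]

/-- The kernel of `lam i - S` is the eigendistribution. This is the equivalence of (b) and (c),
stated at a point. -/
lemma covEnd_eq_zero_iff (hlam : IsEigenfunctions S lam)
    (hgrad : ∀ p, Sc.grad (lam i) p ∈ H.rad p) {p : M} (hX : Sc.η p (X p) = 0)
    (hY : IsSection (eigenDistrib S (lam i)) Y) :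
    Sc.covEnd S X Y p = 0 ↔ Sc.nabla X Y p ∈ eigenDistrib S (lam i) p := by
  rw [covEnd_eq_of_grad hlam hgrad hX hY, sub_eq_zero, mem_eigenDistrib, eq_comm]

/-- For `X, Y ∈ Γ(D_i)`, the form `C(X, Y)` is `η(∇_X Y)`. -/
lemma C_eq_η (hη : ∀ p, Sc.η p (Y p) = 0) (X : VField (n + 1) M) (p : M) :
    Sc.C X Y p = Sc.η p (Sc.nabla X Y p) := by
  have h : (fun q ↦ Sc.P q (Y q)) = Y := funext fun q ↦ Sc.P_eq_self_of_η_eq_zero (hη q)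
  rw [C, hstar, h, G.symm]
  change Sc.η p (Sc.nabla X Y p - Sc.P p (Sc.nabla X Y p)) = _
  rw [map_sub, Sc.η_of_mem (Sc.P_mem _ _), sub_zero]

variable [T2Space M]

/-- The bracket is `∇_X Y - ∇_Y X`, so an autoparallel distribution is involutive. -/
lemma isIntegrable_of_isAutoparallel (hS : Sc.IsATensor S) (hlam : IsEigenfunctions S lam)
    (hD0 : ∀ p, eigenDistrib S (lam 0) p = H.rad p)
    (h : Sc.IsAutoparallel (eigenDistrib S (lam i))) : IsIntegrable (eigenDistrib S (lam i)) := by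
  refine isIntegrable_of_chartBracket hS.smooth hlam (eigenProj_mem hS hlam hD0 i)
    (fun p v hv ↦ eigenProj_of_mem hlam hv) (fun p v hv ↦ exists_isSection_eq hS hlam hD0 hv)
    fun X Y hX hY c z hz ↦ ?_
  have hq := (extChartAt (𝓡 (n + 1)) c).map_target hz
  have h1 := (chartProj_dchart_eq_iff (eigenProj_mem hS hlam hD0 i)
    (fun p v hv ↦ eigenProj_of_mem hlam hv) hq _).mpr
      (Submodule.sub_mem _ (h X Y hX hY _) (h Y X hY hX _))
  rwa [Sc.dchart_nabla_sub_nabla hX.1 hY.1 hq, (extChartAt (𝓡 (n + 1)) c).right_inv hz] at h1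

lemma nabla_sub_nabla_mem_of_isIntegrable (hS : Sc.IsATensor S) (hlam : IsEigenfunctions S lam)
    (hD0 : ∀ p, eigenDistrib S (lam 0) p = H.rad p)
    (h : IsIntegrable (eigenDistrib S (lam i))) (hX : IsSection (eigenDistrib S (lam i)) X)
    (hY : IsSection (eigenDistrib S (lam i)) Y) (p : M) :
    Sc.nabla X Y p - Sc.nabla Y X p ∈ eigenDistrib S (lam i) p := by
  have hp := mem_extChartAt_source (I := 𝓡 (n + 1)) p
  rw [← chartProj_dchart_eq_iff (eigenProj_mem hS hlam hD0 i)
    (fun p v hv ↦ eigenProj_of_mem hlam hv) hp, Sc.dchart_nabla_sub_nabla hX.1 hY.1 hp]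
  exact chartProj_chartBracket_of_isIntegrable hS.smooth hlam (eigenProj_mem hS hlam hD0 i)
    (fun p v hv ↦ eigenProj_of_mem hlam hv) h hX hY p

/-- The polarized Killing condition tests `∇S(X, Y)` against itself and yields that it is null for
`g`. Its component along `ξ` is excluded by the assumption on `C`. -/
lemma covEnd_eq_zero_of_isIntegrable (hgeod : Sc.IsTotallyGeodesic) (hS : Sc.IsATensor S)
    (hlam : IsEigenfunctions S lam) (hD0 : ∀ p, eigenDistrib S (lam 0) p = H.rad p) (hi : i ≠ 0)
    (hgrad : ∀ p, Sc.grad (lam i) p ∈ H.rad p)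
    (hC : ∀ X : VField (n + 1) M, IsSection (eigenDistrib S (lam i)) X → ∀ p, Sc.C X X p = 0)
    (h : IsIntegrable (eigenDistrib S (lam i))) (hX : IsSection (eigenDistrib S (lam i)) X)
    (hY : IsSection (eigenDistrib S (lam i)) Y) (p : M) : Sc.covEnd S X Y p = 0 := by
  have hη : ∀ {X : VField (n + 1) M}, IsSection (eigenDistrib S (lam i)) X →
      ∀ p, Sc.η p (X p) = 0 := fun hX p ↦ hS.η_eq_zero hlam hD0 hi (hX.2 p)
  have hbr := nabla_sub_nabla_mem_of_isIntegrable hS hlam hD0 h hX hY p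
  have hdiag : ∀ {X : VField (n + 1) M}, IsSection (eigenDistrib S (lam i)) X →
      Sc.η p (Sc.nabla X X p) = 0 := fun {X} hX ↦ by
    rw [← C_eq_η (hη hX)]; exact hC X hX p
  -- Polarizing the assumption on `C` kills the symmetric part of `η(∇_X Y)`, and the bracket kills
  -- the antisymmetric part.
  have hηXY : Sc.η p (Sc.nabla X Y p) = 0 := by
    have h1 := hS.η_eq_zero hlam hD0 hi hbr
    have h2 := hdiag (X := fun q ↦ X q + Y q)
      ⟨hX.1.add hY.1, fun q ↦ Submodule.add_mem _ (hX.2 q) (hY.2 q)⟩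
    rw [nabla_add_left, Sc.nabla_add_right _ hX.1 hY.1, Sc.nabla_add_right _ hX.1 hY.1, map_add,
      map_add, map_add, hdiag hX, hdiag hY] at h2
    rw [map_sub] at h1
    linarith
  have hsymm : Sc.covEnd S X Y p = Sc.covEnd S Y X p := by
    rw [covEnd_eq_of_grad hlam hgrad (hη hX p) hY, covEnd_eq_of_grad hlam hgrad (hη hY p) hX,
      ← sub_eq_zero]
    have h1 := mem_eigenDistrib.mp hbr
    rw [map_sub, smul_sub] at h1
    rw [sub_sub_sub_comm, h1, sub_self]
  have hηE : Sc.η p (Sc.covEnd S X Y p) = 0 := by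
    rw [covEnd_eq_of_grad hlam hgrad (hη hX p) hY, map_sub, map_smul, hS.η_apply hD0, hηXY,
      smul_zero, mul_zero, sub_zero]
  -- Only the value of `Z` at `p` matters: `η (Z p) = 0` already gives `Z(lam i) = 0` there, so `Z`
  -- need not be a section of the eigendistribution.
  obtain ⟨Z, hZ, hZp⟩ := exists_smoothField_eq p (Sc.covEnd S X Y p)
  have hηZ : Sc.η p (Z p) = 0 := by rw [hZp, hηE]
  -- By symmetry of `S`, the operator `lam i - S` moves onto `Y p`, which it kills.
  have hvanish : ∀ {X Y : VField (n + 1) M}, IsSection (eigenDistrib S (lam i)) X →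
      IsSection (eigenDistrib S (lam i)) Y → H.g p (Y p) (Sc.covEnd S Z X p) = 0 := by
    intro X Y hX hY
    rw [covEnd_eq_of_grad hlam hgrad hηZ hX, g_symm, g_sub_left, hS.symmetric,
      mem_eigenDistrib.mp (hY.2 p), g_smul_left,
      g_symm _ _ _ (lam i p • Y p), g_smul_left, g_symm _ _ (Y p), sub_self]
  have hk := hS.killing_polarized hX.1 hY.1 hZ p
  simp only [flat_apply, hη hX p, hη hY p, hηZ, zero_mul, add_zero, hvanish hX hY,
    hvanish hY hX] at hk
  -- The symmetry of `∇_X S` and `∇_Y S` turns each of the four surviving terms into `g(E, E)` with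
  -- `E = ∇S(X, Y)` at `p`.
  rw [g_symm _ _ (X p), g_symm _ _ (Y p), hS.g_covEnd hgeod hY.1 hZ hX.1,
    hS.g_covEnd hgeod hX.1 hZ hY.1, ← hsymm, hZp, g_symm _ _ (Sc.covEnd S X Y p)] at hk
  exact Sc.eq_zero_of_g_eq_zero hηE (by linarith)

end Screen

end Hypersurface

end Lightlike

end

/-! ### The equivalence of (a), (b) and (c) -/

open Lightlike

theorem fact5p4 {n k : ℕ}
    {Mbar : Type*} [TopologicalSpace Mbar] [T2Space Mbar] [SecondCountableTopology Mbar]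
    [ChartedSpace (EuclideanSpace ℝ (Fin (n + 2))) Mbar] [IsManifold (𝓡 (n + 2)) ∞ Mbar]
    {M : Type*} [TopologicalSpace M] [T2Space M] [SecondCountableTopology M]
    [ChartedSpace (EuclideanSpace ℝ (Fin (n + 1))) M] [IsManifold (𝓡 (n + 1)) ∞ M]
    [ConnectedSpace M]
    (G : LorentzMetric (n + 2) Mbar) (H : Hypersurface G M) (Sc : H.Screen)
    (hgeod : Sc.IsTotallyGeodesic)
    (S : ∀ p : M, TangentSpace (𝓡 (n + 1)) p →L[ℝ] TangentSpace (𝓡 (n + 1)) p)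
    (hS : Sc.IsATensor S)
    (lam : Fin (k + 1) → M → ℝ) (hlam : IsEigenfunctions S lam)
    (hD0 : ∀ p, eigenDistrib S (lam 0) p = H.rad p)
    (i : Fin (k + 1)) (hi : i ≠ 0)
    (hgrad : ∀ p, Sc.grad (lam i) p ∈ eigenDistrib S (lam 0) p)
    (hC : ∀ X : VField (n + 1) M, IsSection (eigenDistrib S (lam i)) X → ∀ p, Sc.C X X p = 0) :
    [IsIntegrable (eigenDistrib S (lam i)),
      ∀ X Y : VField (n + 1) M, IsSection (eigenDistrib S (lam i)) X →
        IsSection (eigenDistrib S (lam i)) Y → ∀ p, Sc.covEnd S X Y p = 0,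
      Sc.IsAutoparallel (eigenDistrib S (lam i))].TFAE := by
  have hgrad' : ∀ p, Sc.grad (lam i) p ∈ H.rad p := fun p ↦ hD0 p ▸ hgrad p
  have hiff : ∀ X Y : VField (n + 1) M, IsSection (eigenDistrib S (lam i)) X →
      IsSection (eigenDistrib S (lam i)) Y → ∀ p,
      (Sc.covEnd S X Y p = 0 ↔ Sc.nabla X Y p ∈ eigenDistrib S (lam i) p) :=
    fun X Y hX hY p ↦ Hypersurface.Screen.covEnd_eq_zero_iff hlam hgrad'
      (hS.η_eq_zero hlam hD0 hi (hX.2 p)) hY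
  tfae_have 1 → 2 := fun h X Y hX hY p ↦
    Hypersurface.Screen.covEnd_eq_zero_of_isIntegrable hgeod hS hlam hD0 hi hgrad' hC h hX hY p
  tfae_have 2 → 3 := fun h X Y hX hY p ↦ (hiff X Y hX hY p).mp (h X Y hX hY p)
  tfae_have 3 → 1 := Hypersurface.Screen.isIntegrable_of_isAutoparallel hS hlam hD0
  tfae_finish
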